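/- Let $K$ be a field, $S=K[t_1,\ldots,t_s]=\bigoplus_{d\ge 0}S_d$ with the standard grading, and $\prec$ a monomial order on $S$. For a graded ideal $J\subset S$ put $H_J(d)=\dim_K(S_d/(J\cap S_d))$ and, with $k=\dim(S/J)$ the Krull dimension, $\deg(S/J)=(k-1)!\lim_{d\to\infty}H_J(d)/d^{k-1}$ if $k\ge 1$ and $\deg(S/J)=\dim_K(S/J)$ if $k=0$; put $\deg(S/S)=0$. Let $I\subset S$ be a graded ideal. Let $\mathrm{in}_\prec(I)$ be the ideal generated by the leading monomials of the nonzero elements of $I$, let $\Delta_\prec(I)$ be the set of standard monomials (the monomials that are not the leading monomial of a nonzero element of $I$), and put $\Delta_\prec(I)_d=\Delta_\prec(I)\cap S_d$. For $d\ge 0$ let $\mathcal F_d=\{f\in S_d : f\notin I,\ (I:f)\ne I\}$, where $(I:f)=\{h\in S: hf\in I\}$, and define $$\delta_I(d)=\deg(S/I)-\max\{\deg(S/(I,f)) : f\in\mathcal F_d\},\qquad \mathrm{fp}_I(d)=\deg(S/I)-\max\{\deg(S/(\mathrm{in}_\prec(I),t^a)) : t^a\in\Delta_\prec(I)_d\},$$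 where $\delta_I(d)=\deg(S/I)$ if $\mathcal F_d=\emptyset$ and $\mathrm{fp}_I(d)=\deg(S/I)$ if $\Delta_\prec(I)_d=\emptyset$. Assume that $I$ is unmixed (all associated primes of $I$ have the same height), that $\dim(S/I)\ge 1$, and that each $t_i$, $i=1,\ldots,s$, is a zero-divisor of $S/I$. Then: (i) $\mathcal F_d\ne\emptyset$ for all $d\ge 1$ (and the maximum defining $\delta_I(d)$ exists); (ii) $\delta_I(d)\ge \mathrm{fp}_I(d)$ for all $d\ge 1$; (iii) $\deg(S/(I,t^a))\le\deg(S/(\mathrm{in}_\prec(I),t^a))\le\deg(S/I)$ for every standard monomial $t^a\in\Delta_\prec(I)$; (iv) $\mathrm{fp}_I(d)\ge 0$ for all $d\ge 0$; (v) $\delta_I(d)\ge\delta_I(d+1)\ge 0$ for all $d\ge 1$; (vi) if $I$ is a radical ideal and its associated primes are generated by linear forms, then there is an integer $r\ge 1$ such that $\delta_I(1)>\delta_I(2)>\cdots>\delta_I(r)=\delta_I(d)=1$ for all $d\ge r$. -/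

import Mathlib

universe u v

open MvPolynomial Filter Topology

noncomputable section

namespace FootprintIdeal

variable {K : Type u} [Field K] {s : ℕ}

/-- Graded ideals of `S = K[t_1, …, t_s]`, for the standard grading: the homogeneous
components of every element of `I` are in `I`. -/
def IsGraded (I : Ideal (MvPolynomial (Fin s) K)) : Prop :=
  ∀ f ∈ I, ∀ d : ℕ, homogeneousComponent d f ∈ I

/-- The Hilbert function `H_I(d) = dim_K (S_d / I_d)`, where `I_d = I ∩ S_d`. -/
def hilbertFn (I : Ideal (MvPolynomial (Fin s) K)) (d : ℕ) : ℕ :=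
  Module.finrank K
    (homogeneousSubmodule (Fin s) K d ⧸
      (I.restrictScalars K).submoduleOf (homogeneousSubmodule (Fin s) K d))

/-- The Krull dimension of `S/I` as a natural number (with value `0` for the zero ring; the Krull
dimension of `S/I` is at most `s`, so it is never infinite). -/
def dim (I : Ideal (MvPolynomial (Fin s) K)) : ℕ :=
  ((ringKrullDim (MvPolynomial (Fin s) K ⧸ I)).unbotD 0).toNat

/-- The degree (multiplicity) `deg(S/I)` of a graded ideal: with `k = dim (S/I)`, it is the
integer `(k-1)! * lim_{d → ∞} H_I(d) / d^(k-1)` if `k ≥ 1`, and `dim_K (S/I)` if `k = 0`.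
By the classical theorem of Hilbert the limit exists and is a natural number, so that the set
below is a singleton whose only element is taken. For `I = S` the value is `dim_K 0 = 0`. -/
def degree (I : Ideal (MvPolynomial (Fin s) K)) : ℕ :=
  if 1 ≤ dim I then
    sInf {n : ℕ | Tendsto
      (fun d : ℕ => ((dim I - 1).factorial : ℝ) * ((hilbertFn I d : ℝ) / (d : ℝ) ^ (dim I - 1)))
      atTop (𝓝 (n : ℝ))}
  else Module.finrank K (MvPolynomial (Fin s) K ⧸ I)

/-- `f` is a zero-divisor of `S/I`: there is `g ∉ I` with `f * g ∈ I`. -/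
def IsZeroDivisorMod (I : Ideal (MvPolynomial (Fin s) K)) (f : MvPolynomial (Fin s) K) : Prop :=
  ∃ g, g ∉ I ∧ f * g ∈ I

/-- All associated primes of `I` (that is, of the module `S/I`) have the same height. -/
def IsUnmixed (I : Ideal (MvPolynomial (Fin s) K)) : Prop :=
  ∀ p ∈ associatedPrimes (MvPolynomial (Fin s) K) (MvPolynomial (Fin s) K ⧸ I),
    ∀ q ∈ associatedPrimes (MvPolynomial (Fin s) K) (MvPolynomial (Fin s) K ⧸ I),
      p.height = q.height

/-- An ideal generated by linear forms. -/
def IsLinearlyGenerated (p : Ideal (MvPolynomial (Fin s) K)) : Prop :=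
  ∃ A : Set (MvPolynomial (Fin s) K), (∀ l ∈ A, l.IsHomogeneous 1) ∧ p = Ideal.span A

/-- `F_d = {f ∈ S_d | f ∉ I, (I : f) ≠ I}`. -/
def zeroDivisorForms (I : Ideal (MvPolynomial (Fin s) K)) (d : ℕ) :
    Set (MvPolynomial (Fin s) K) :=
  {f | f.IsHomogeneous d ∧ f ∉ I ∧ I.colon {f} ≠ I}

open Classical in
/-- The minimum distance function `δ_I`. -/
def minDist (I : Ideal (MvPolynomial (Fin s) K)) (d : ℕ) : ℤ :=
  if (zeroDivisorForms I d).Nonempty then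
    (degree I : ℤ) -
      (sSup ((fun f => degree (I ⊔ Ideal.span {f})) '' zeroDivisorForms I d) : ℕ)
  else (degree I : ℤ)

/-- The initial ideal `in_≺(I)`, generated by the leading monomials of the nonzero elements
of `I`. -/
def initialIdeal (m : MonomialOrder.{0, v} (Fin s)) (I : Ideal (MvPolynomial (Fin s) K)) :
    Ideal (MvPolynomial (Fin s) K) :=
  Ideal.span {h | ∃ f ∈ I, f ≠ 0 ∧ h = monomial (m.degree f) (1 : K)}

/-- The footprint `Δ_≺(I)`, as a set of exponents: `t^a` is standard if it is not the leading
monomial of any (nonzero) polynomial of `I`. -/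
def footprint (m : MonomialOrder.{0, v} (Fin s)) (I : Ideal (MvPolynomial (Fin s) K)) :
    Set (Fin s →₀ ℕ) :=
  {a | ¬ ∃ f ∈ I, f ≠ 0 ∧ m.degree f = a}

/-- `Δ_≺(I)_d`: the standard monomials of total degree `d`. There are finitely many. -/
def footprintDeg (m : MonomialOrder.{0, v} (Fin s)) (I : Ideal (MvPolynomial (Fin s) K))
    (d : ℕ) : Set (Fin s →₀ ℕ) :=
  {a | a ∈ footprint m I ∧ Finsupp.degree a = d}

open Classical in
/-- The footprint function `fp_I`. -/
def footprintFn (m : MonomialOrder.{0, v} (Fin s)) (I : Ideal (MvPolynomial (Fin s) K))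
    (d : ℕ) : ℤ :=
  if (footprintDeg m I d).Nonempty then
    (degree I : ℤ) -
      (sSup ((fun a => degree (initialIdeal m I ⊔ Ideal.span {monomial a (1 : K)})) ''
        footprintDeg m I d) : ℕ)
  else (degree I : ℤ)

end FootprintIdeal

end

/-! Everything is read off the Hilbert function. For a graded ideal `I` and a form `f` of degree
`e`, multiplication by `f` gives `H_I(d+e) = H_(I:f)(d) + H_(I,f)(d+e)` (`hilbertFn_add`).
Noetherian induction with this identity, reducing to graded primes, shows that `H_I` is eventually
polynomial of degree `dim(S/I) - 1` (`hasHilbertDim_hilbertFn`), and that height and dimension of a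
graded prime add up to `s`. Hence `degree` is an eventual iterated difference of `H_I`, positive,
monotone in the Hilbert function at fixed dimension, and additive along the identity.

Unmixedness makes `(I:f)` and `(I,f)` keep the dimension of `S/I` when `f ∉ I` is a form that is a
zero-divisor. Therefore `deg(S/I) = deg(S/(I:f)) + deg(S/(I,f))`, and the minimum distance is the
least degree of a colon ideal `(I:f)`, which is at least 1.

The footprint bounds come from counting standard monomials: `I` and its initial ideal have equal
Hilbert functions, and adjoining the leading monomial of `f` to the initial ideal gives a Hilbert
function between those of `(I,f)` and `I`. Modulo `I`, any form outside `I` may be replaced by one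
with a standard leading monomial. Nonemptiness uses powers of a variable, and monotonicity uses
multiplication by a variable.

For radical `I` with linear associated primes, each relevant prime has degree at most 1. If
`deg(S/(I:f)) ≥ 2`, then `(I:f)` has two distinct minimal primes, and multiplying `f` by a linear
form in one but not in the other strictly lowers the degree (`exists_linear_mul`). The minimum
distance thus strictly decreases until it reaches 1. -/

noncomputable section

namespace FootprintIdeal

/-! ### Eventually polynomial functions through iterated differences -/

/-- The `j`-th forward difference of `H` is eventually equal to `e`. -/
def HasDiff (H : ℕ → ℕ) (j : ℕ) (e : ℤ) : Prop :=
  ∀ᶠ d in atTop, (fwdDiff 1)^[j] (fun n => (H n : ℤ)) d = e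

theorem HasDiff.unique {H : ℕ → ℕ} {j : ℕ} {e e' : ℤ} (h : HasDiff H j e) (h' : HasDiff H j e') :
    e = e' := by
  obtain ⟨d, hd, hd'⟩ := (Filter.Eventually.and h h').exists
  exact hd.symm.trans hd'

theorem HasDiff.succ {H : ℕ → ℕ} {j : ℕ} {e : ℤ} (h : HasDiff H j e) : HasDiff H (j + 1) 0 := by
  have h1 := (tendsto_add_atTop_nat 1).eventually h
  filter_upwards [h, h1] with d hd hd1
  rw [Function.iterate_succ_apply', fwdDiff, hd, hd1, sub_self]

theorem HasDiff.of_lt {H : ℕ → ℕ} {j k : ℕ} {e : ℤ} (h : HasDiff H j e) (hjk : j < k) :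
    HasDiff H k 0 := by
  induction k, hjk using Nat.le_induction with
  | base => exact h.succ
  | succ k _ ih => exact ih.succ

theorem hasDiff_shift {H : ℕ → ℕ} {j : ℕ} {e : ℤ} (c : ℕ) :
    HasDiff (fun d => H (d + c)) j e ↔ HasDiff H j e := by
  unfold HasDiff
  have : ∀ d, (fwdDiff 1)^[j] (fun n => (H (n + c) : ℤ)) d =
      (fwdDiff 1)^[j] (fun n => (H n : ℤ)) (d + c) := fun d =>
    fwdDiff_iter_comp_add 1 (fun n => (H n : ℤ)) c j d
  simp only [this]
  exact ⟨fun h => by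
    rw [eventually_atTop] at h ⊢
    obtain ⟨a, ha⟩ := h
    refine ⟨a + c, fun b hb => ?_⟩
    have := ha (b - c) (by omega)
    rwa [Nat.sub_add_cancel (by omega)] at this,
    fun h => (tendsto_add_atTop_nat c).eventually h⟩

/-- The relation is the one satisfied by Hilbert functions along multiplication by a form of degree
`c`; a shift of the argument does not affect an eventual constant. -/
theorem HasDiff.add {H A B : ℕ → ℕ} {j c : ℕ} {a b : ℤ} (h : ∀ d, H (d + c) = A d + B (d + c))
    (hA : HasDiff A j a) (hB : HasDiff B j b) : HasDiff H j (a + b) := by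
  rw [← hasDiff_shift c] at hB ⊢
  filter_upwards [hA, hB] with d h1 h2
  have : (fun n => (H (n + c) : ℤ)) = (fun n => (A n : ℤ)) + fun n => (B (n + c) : ℤ) := by
    funext n; simp [h]
  rw [this, fwdDiff_iter_add, Pi.add_apply, h1, h2]

theorem HasDiff.integrate {H B : ℕ → ℕ} {j : ℕ} {e : ℤ} (h : ∀ d, H (d + 1) = H d + B (d + 1))
    (hB : HasDiff B j e) : HasDiff H (j + 1) e := by
  rw [← hasDiff_shift 1] at hB
  filter_upwards [hB] with d hd
  have hΔ : fwdDiff 1 (fun n => (H n : ℤ)) = fun n => (B (n + 1) : ℤ) := by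
    funext n
    simp [fwdDiff, h]
  rw [← hd, Function.iterate_succ_apply, hΔ]

theorem HasDiff.eventually_eq_const {H B : ℕ → ℕ} (h : ∀ d, H (d + 1) = H d + B (d + 1))
    (hB : HasDiff B 0 0) : ∃ e : ℤ, HasDiff H 0 e := by
  obtain ⟨N, hN⟩ := eventually_atTop.1 hB
  refine ⟨H N, eventually_atTop.2 ⟨N, fun n hn => ?_⟩⟩
  induction n, hn using Nat.le_induction with
  | base => simp
  | succ n hn ih =>
    have := hN (n + 1) (by omega)
    simp only [Function.iterate_zero, id] at this ih ⊢
    rw [h, Nat.cast_add, this, ih, add_zero]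

theorem tendsto_choose_div_pow (k : ℕ) :
    Tendsto (fun n : ℕ => (n.choose k : ℝ) / (n : ℝ) ^ k) atTop (𝓝 (1 / (k.factorial : ℝ))) := by
  have h := (isEquivalent_choose k).div (Asymptotics.IsEquivalent.refl (u := fun n : ℕ => (n : ℝ) ^ k))
  have h2 : Tendsto (fun n : ℕ => ((n : ℝ) ^ k / k.factorial) / (n : ℝ) ^ k) atTop
      (𝓝 (1 / (k.factorial : ℝ))) := by
    refine tendsto_const_nhds.congr' ?_
    filter_upwards [eventually_gt_atTop 0] with n hn
    have : (n : ℝ) ^ k ≠ 0 := by positivity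
    field_simp
  exact h.symm.tendsto_nhds h2

theorem tendsto_choose_div_pow_of_lt {k j : ℕ} (h : k < j) :
    Tendsto (fun n : ℕ => (n.choose k : ℝ) / (n : ℝ) ^ j) atTop (𝓝 0) := by
  have h1 : Tendsto (fun n : ℕ => ((n : ℝ) ^ (j - k))⁻¹) atTop (𝓝 0) :=
    ((tendsto_pow_atTop (by omega)).comp tendsto_natCast_atTop_atTop).inv_tendsto_atTop
  have h2 := (tendsto_choose_div_pow k).mul h1
  rw [mul_zero] at h2
  refine h2.congr fun n => ?_
  rw [div_mul_eq_mul_div, div_eq_mul_inv, div_eq_mul_inv, mul_assoc, ← mul_inv, ← pow_add,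
    Nat.sub_add_cancel h.le]

/-- A function whose `j`-th difference is eventually `e` grows like `e * d ^ j / j!`. -/
theorem HasDiff.tendsto {H : ℕ → ℕ} {j : ℕ} {e : ℤ} (h : HasDiff H j e) :
    Tendsto (fun d : ℕ => (j.factorial : ℝ) * ((H d : ℝ) / (d : ℝ) ^ j)) atTop (𝓝 (e : ℝ)) := by
  obtain ⟨N, hN⟩ := eventually_atTop.1 h
  set F : ℕ → ℤ := fun n => (H n : ℤ)
  have hz : ∀ i, j < i → (fwdDiff 1)^[i] F N = 0 := by
    intro i hi
    obtain ⟨i, rfl⟩ := Nat.exists_eq_add_of_lt hi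
    have : ∀ i d, N ≤ d → (fwdDiff 1)^[j + i + 1] F d = 0 := by
      intro i
      induction i with
      | zero =>
        intro d hd
        rw [add_zero, Function.iterate_succ_apply', fwdDiff, hN d hd, hN _ (by omega), sub_self]
      | succ i ih =>
        intro d hd
        rw [← add_assoc, Function.iterate_succ_apply', fwdDiff, ih d hd, ih _ (by omega), sub_self]
    exact this i N le_rfl
  -- Newton's forward formula based at `N`: differences of order above `j` vanish there, so the sum
  -- stops at `j`, and only its last term survives division by `n ^ j`.
  have hF : ∀ n, (H (N + n) : ℝ) =
      ∑ k ∈ Finset.range (j + 1), (n.choose k : ℝ) * ((fwdDiff 1)^[k] F N : ℤ) := by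
    intro n
    have h1 := shift_eq_sum_fwdDiff_iter 1 F n N
    have h2 : ∑ k ∈ Finset.range (n + 1), n.choose k • (fwdDiff 1)^[k] F N =
        ∑ k ∈ Finset.range (j + 1), n.choose k • (fwdDiff 1)^[k] F N := by
      rcases le_total n j with hnj | hnj
      · refine Finset.sum_subset (by simpa using hnj) fun k _ hk => ?_
        rw [Nat.choose_eq_zero_of_lt (by simpa using hk), zero_smul]
      · refine (Finset.sum_subset (by simpa using hnj) fun k _ hk => ?_).symm
        rw [hz k (by simpa using hk), smul_zero]
    rw [h2] at h1
    have h3 := congrArg (fun z : ℤ => (z : ℝ)) h1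
    simpa [F] using h3
  have hlim : Tendsto (fun n : ℕ => (H (N + n) : ℝ) / (n : ℝ) ^ j) atTop
      (𝓝 ((1 / (j.factorial : ℝ)) * e)) := by
    simp only [hF, Finset.sum_range_succ, hN N le_rfl, add_div]
    have h0 : Tendsto (fun n : ℕ => (∑ k ∈ Finset.range j,
        (n.choose k : ℝ) * ((fwdDiff 1)^[k] F N : ℤ)) / (n : ℝ) ^ j) atTop (𝓝 0) := by
      simp only [Finset.sum_div]
      rw [← Finset.sum_const_zero (s := Finset.range j)]
      refine tendsto_finsetSum _ fun k hk => ?_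
      have := (tendsto_choose_div_pow_of_lt (Finset.mem_range.1 hk)).mul_const
        (((fwdDiff 1)^[k] F N : ℤ) : ℝ)
      rw [zero_mul] at this
      exact this.congr fun n => by ring
    have h1 := (tendsto_choose_div_pow j).mul_const (e : ℝ)
    have h2 := h0.add h1
    rw [zero_add] at h2
    exact h2.congr fun n => by ring
  -- Trades the denominator `n ^ j` for `(n + N) ^ j`, matching the argument of `H`.
  have hratio : Tendsto (fun n : ℕ => ((n : ℝ) / ((n + N : ℕ) : ℝ)) ^ j) atTop (𝓝 1) := by
    have : Tendsto (fun n : ℕ => (n : ℝ) / ((n + N : ℕ) : ℝ)) atTop (𝓝 1) := by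
      have := tendsto_natCast_div_add_atTop (𝕜 := ℝ) (N : ℝ)
      simpa using this
    simpa using this.pow j
  rw [← tendsto_add_atTop_iff_nat N]
  have h3 := ((hlim.mul hratio).const_mul (j.factorial : ℝ))
  have hj : (j.factorial : ℝ) ≠ 0 := by positivity
  have h4 : (j.factorial : ℝ) * (1 / (j.factorial : ℝ) * e * 1) = e := by field_simp
  rw [h4] at h3
  refine h3.congr' ?_
  filter_upwards [eventually_gt_atTop 0] with n hn
  have : (n : ℝ) ≠ 0 := by positivity
  rw [add_comm N n, div_pow]
  field_simp

theorem HasDiff.mono {A B : ℕ → ℕ} {j : ℕ} {a b : ℤ} (hA : HasDiff A j a) (hB : HasDiff B j b)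
    (h : ∀ d, A d ≤ B d) : a ≤ b := by
  have := le_of_tendsto_of_tendsto' hA.tendsto hB.tendsto fun d => by
    gcongr
    exact h d
  exact_mod_cast this

/-- `H` is eventually a polynomial function of degree `k - 1` (eventually zero if `k = 0`). -/
def HasHilbertDim (H : ℕ → ℕ) (k : ℕ) : Prop :=
  (k = 0 ∧ HasDiff H 0 0) ∨ ∃ j, ∃ e : ℤ, k = j + 1 ∧ 0 < e ∧ HasDiff H j e

theorem HasHilbertDim.hasDiff_zero {H : ℕ → ℕ} {k j : ℕ} (h : HasHilbertDim H k) (hk : k ≤ j) :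
    HasDiff H j 0 := by
  rcases h with ⟨rfl, h⟩ | ⟨i, e, rfl, -, h⟩
  · rcases Nat.eq_zero_or_pos j with rfl | hj
    · exact h
    · exact h.of_lt hj
  · exact h.of_lt hk

theorem HasHilbertDim.exists_hasDiff {H : ℕ → ℕ} {k : ℕ} (h : HasHilbertDim H (k + 1)) :
    ∃ e : ℤ, 0 < e ∧ HasDiff H k e := by
  rcases h with ⟨h, -⟩ | ⟨i, e, hk, he, h⟩
  · omega
  · obtain rfl : k = i := by omega
    exact ⟨e, he, h⟩

theorem HasHilbertDim.mono {A B : ℕ → ℕ} {a b : ℕ} (hA : HasHilbertDim A a)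
    (hB : HasHilbertDim B b) (h : ∀ d, A d ≤ B d) : a ≤ b := by
  by_contra! hlt
  obtain ⟨a, rfl⟩ : ∃ c, a = c + 1 := ⟨a - 1, by omega⟩
  obtain ⟨e, he, hA⟩ := hA.exists_hasDiff
  have := hA.mono (hB.hasDiff_zero (Nat.lt_succ_iff.1 hlt)) h
  omega

/-- The leading differences are positive, so they cannot cancel and the larger growth wins. -/
theorem HasHilbertDim.add {H A B : ℕ → ℕ} {a b c : ℕ} (h : ∀ d, H (d + c) = A d + B (d + c))
    (hA : HasHilbertDim A a) (hB : HasHilbertDim B b) : HasHilbertDim H (max a b) := by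
  rcases hk : max a b with _ | k
  · exact Or.inl ⟨rfl, HasDiff.add h (hA.hasDiff_zero (by omega)) (hB.hasDiff_zero (by omega))⟩
  · have key : ∀ {F : ℕ → ℕ} {f : ℕ}, HasHilbertDim F f → f ≤ k + 1 →
        ∃ e : ℤ, 0 ≤ e ∧ (f = k + 1 → 0 < e) ∧ HasDiff F k e := by
      intro F f hF hf
      rcases hf.eq_or_lt with rfl | hf
      · obtain ⟨e, he, hF⟩ := hF.exists_hasDiff
        exact ⟨e, he.le, fun _ => he, hF⟩
      · exact ⟨0, le_rfl, fun h => by omega, hF.hasDiff_zero (by omega)⟩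
    obtain ⟨e, he, he', hA⟩ := key hA (by omega)
    obtain ⟨e₂, he₂, he₂', hB⟩ := key hB (by omega)
    refine Or.inr ⟨k, e + e₂, rfl, ?_, HasDiff.add h hA hB⟩
    rcases (by omega : a = k + 1 ∨ b = k + 1) with ha | hb
    · have := he' ha; omega
    · have := he₂' hb; omega

/-- If `B` is eventually zero then `H` is eventually constant; `hH` excludes the constant 0, for
which the exponent would not go up. -/
theorem HasHilbertDim.integrate {H B : ℕ → ℕ} {k : ℕ} (h : ∀ d, H (d + 1) = H d + B (d + 1))
    (hB : HasHilbertDim B k) (hH : ¬ HasDiff H 0 0) : HasHilbertDim H (k + 1) := by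
  rcases hB with ⟨rfl, hB⟩ | ⟨j, e, rfl, he, hB⟩
  · obtain ⟨e, he⟩ := HasDiff.eventually_eq_const h hB
    refine Or.inr ⟨0, e, rfl, ?_, he⟩
    obtain ⟨d, hd⟩ := Filter.Eventually.exists he
    have h0 : e ≠ 0 := fun h0 => hH (h0 ▸ he)
    have h1 : 0 ≤ e := by rw [← hd]; simp
    omega
  · exact Or.inr ⟨j + 1, e, rfl, he, HasDiff.integrate h hB⟩

/-- Pascal's rule makes each additional variable one more summation. -/
theorem hasDiff_multichoose (r : ℕ) : HasDiff (Nat.multichoose (r + 1)) r 1 := by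
  induction r with
  | zero => exact Eventually.of_forall fun d => by simp
  | succ r ih =>
    refine HasDiff.integrate (fun d => ?_) ih
    rw [Nat.multichoose_succ_succ, add_comm]

theorem hasHilbertDim_multichoose (r : ℕ) : HasHilbertDim (Nat.multichoose r) r := by
  rcases r with _ | r
  · refine Or.inl ⟨rfl, eventually_atTop.2 ⟨1, fun d hd => ?_⟩⟩
    obtain ⟨d, rfl⟩ : ∃ c, d = c + 1 := ⟨d - 1, by omega⟩
    simp
  · exact Or.inr ⟨r, 1, rfl, one_pos, hasDiff_multichoose r⟩

/-! ### Graded ideals and the Hilbert function along multiplication by a form -/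

section Graded

variable {K : Type u} [Field K] {s : ℕ}

attribute [local instance] MvPolynomial.gradedAlgebra

theorem isGraded_iff {I : Ideal (MvPolynomial (Fin s) K)} :
    IsGraded I ↔ I.IsHomogeneous (homogeneousSubmodule (Fin s) K) :=
  ⟨fun h i r hr => by
    have := h r hr i
    rwa [← decomposition.decompose'_apply] at this,
   fun h f hf d => homogeneousComponent_mem_of_mem h hf d⟩

theorem homogeneousComponent_mul_of_right {f g : MvPolynomial (Fin s) K} {e : ℕ}
    (hf : f.IsHomogeneous e) (d : ℕ) :
    homogeneousComponent (d + e) (g * f) = homogeneousComponent d g * f := by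
  have h := DirectSum.coe_decompose_mul_of_right_mem_of_le (homogeneousSubmodule (Fin s) K)
    (a := g) (n := d + e) (show f ∈ homogeneousSubmodule (Fin s) K e from hf) (by omega)
  rw [Nat.add_sub_cancel] at h
  rw [← decomposition.decompose'_apply, ← decomposition.decompose'_apply]
  exact h

theorem IsGraded.sup {I J : Ideal (MvPolynomial (Fin s) K)} (hI : IsGraded I) (hJ : IsGraded J) :
    IsGraded (I ⊔ J) :=
  isGraded_iff.2 ((isGraded_iff.1 hI).sup (isGraded_iff.1 hJ))

theorem isGraded_span {A : Set (MvPolynomial (Fin s) K)} (h : ∀ f ∈ A, ∃ d, f.IsHomogeneous d) :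
    IsGraded (Ideal.span A) :=
  isGraded_iff.2 (Ideal.homogeneous_span _ _ h)

theorem IsGraded.sup_span {I : Ideal (MvPolynomial (Fin s) K)} (hI : IsGraded I)
    {f : MvPolynomial (Fin s) K} {e : ℕ} (hf : f.IsHomogeneous e) :
    IsGraded (I ⊔ Ideal.span {f}) :=
  hI.sup (isGraded_span fun g hg => ⟨e, by rwa [Set.mem_singleton_iff.1 hg]⟩)

theorem mem_colon_iff {I : Ideal (MvPolynomial (Fin s) K)} {f g : MvPolynomial (Fin s) K} :
    g ∈ I.colon {f} ↔ g * f ∈ I := by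
  simp

theorem IsGraded.colon {I : Ideal (MvPolynomial (Fin s) K)} (hI : IsGraded I)
    {f : MvPolynomial (Fin s) K} {e : ℕ} (hf : f.IsHomogeneous e) : IsGraded (I.colon {f}) := by
  intro g hg d
  rw [mem_colon_iff] at hg ⊢
  rw [← homogeneousComponent_mul_of_right hf]
  exact hI _ hg _

theorem IsGraded.homogeneousCore (I : Ideal (MvPolynomial (Fin s) K)) :
    IsGraded (I.homogeneousCore (homogeneousSubmodule (Fin s) K)).toIdeal :=
  isGraded_iff.2 (HomogeneousIdeal.isHomogeneous _)

theorem IsGraded.le_homogeneousCore {I J : Ideal (MvPolynomial (Fin s) K)} (hI : IsGraded I)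
    (h : I ≤ J) : I ≤ (J.homogeneousCore (homogeneousSubmodule (Fin s) K)).toIdeal := by
  have := (isGraded_iff.1 hI).toIdeal_homogeneousCore_eq_self
  rw [← this]
  exact Ideal.homogeneousCore_mono _ h

/-- The homogeneous core of a prime is prime and still contains the graded ideal `I`, so minimality
forces `q` to equal its core. -/
theorem IsGraded.of_minimalPrimes {I q : Ideal (MvPolynomial (Fin s) K)} (hI : IsGraded I)
    (hq : q ∈ I.minimalPrimes) : IsGraded q := by
  have h1 : q ≤ (q.homogeneousCore (homogeneousSubmodule (Fin s) K)).toIdeal :=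
    hq.2 ⟨hq.1.1.homogeneousCore, hI.le_homogeneousCore hq.1.2⟩ (Ideal.toIdeal_homogeneousCore_le _ _)
  rw [le_antisymm h1 (Ideal.toIdeal_homogeneousCore_le _ _)]
  exact IsGraded.homogeneousCore q

theorem IsGraded.exists_of_not_isPrime {I : Ideal (MvPolynomial (Fin s) K)} (hI : IsGraded I)
    (htop : I ≠ ⊤) (hp : ¬ I.IsPrime) :
    ∃ f g : MvPolynomial (Fin s) K, ∃ e, f.IsHomogeneous e ∧ f ∉ I ∧ g ∉ I ∧ g * f ∈ I := by
  by_contra! hcon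
  refine hp ((isGraded_iff.1 hI).isPrime_of_homogeneous_mem_or_mem htop ?_)
  rintro x y ⟨e, hx⟩ - hxy
  by_contra! h
  exact hcon x y e hx h.1 h.2 (by rwa [mul_comm])

instance finite_homogeneousSubmodule (d : ℕ) :
    Module.Finite K (homogeneousSubmodule (Fin s) K d) :=
  Module.Finite.iff_fg.2 (homogeneousSubmodule_fg (Fin s) K d)

/-- The degree `d` part of `I`, as a subspace of `S_d`. -/
abbrev gradedPiece (I : Ideal (MvPolynomial (Fin s) K)) (d : ℕ) :
    Submodule K (homogeneousSubmodule (Fin s) K d) :=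
  (I.restrictScalars K).submoduleOf (homogeneousSubmodule (Fin s) K d)

theorem mem_gradedPiece {I : Ideal (MvPolynomial (Fin s) K)} {d : ℕ}
    {x : homogeneousSubmodule (Fin s) K d} :
    x ∈ gradedPiece I d ↔ (x : MvPolynomial (Fin s) K) ∈ I := Iff.rfl

theorem hilbertFn_anti {I J : Ideal (MvPolynomial (Fin s) K)} (h : I ≤ J) (d : ℕ) :
    hilbertFn J d ≤ hilbertFn I d := by
  have hle : gradedPiece I d ≤ gradedPiece J d := fun x hx => h hx
  exact LinearMap.finrank_le_finrank_of_surjective (f := Submodule.factor hle)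
    (Submodule.factor_surjective hle)

theorem hilbertFn_eq_zero {I : Ideal (MvPolynomial (Fin s) K)} {d : ℕ}
    (h : ∀ f : MvPolynomial (Fin s) K, f.IsHomogeneous d → f ∈ I) : hilbertFn I d = 0 := by
  have : Subsingleton (homogeneousSubmodule (Fin s) K d ⧸ gradedPiece I d) := by
    rw [Submodule.Quotient.subsingleton_iff, eq_top_iff]
    exact fun x _ => h x x.2
  exact Module.finrank_zero_of_subsingleton

theorem mem_of_hilbertFn_eq_zero {I : Ideal (MvPolynomial (Fin s) K)} {d : ℕ}
    (h : hilbertFn I d = 0) {f : MvPolynomial (Fin s) K} (hf : f.IsHomogeneous d) : f ∈ I := by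
  have : Subsingleton (homogeneousSubmodule (Fin s) K d ⧸ gradedPiece I d) :=
    Module.finrank_zero_iff.1 h
  rw [Submodule.Quotient.subsingleton_iff] at this
  have h2 : (⟨f, hf⟩ : homogeneousSubmodule (Fin s) K d) ∈ gradedPiece I d := by
    rw [this]; trivial
  exact h2

/-- Multiplication by a form `f` of degree `e`, as a map `S_d → (S/I)_{d+e}`. -/
def mulForm (I : Ideal (MvPolynomial (Fin s) K)) {f : MvPolynomial (Fin s) K} {e : ℕ}
    (hf : f.IsHomogeneous e) (d : ℕ) :
    homogeneousSubmodule (Fin s) K d →ₗ[K]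
      homogeneousSubmodule (Fin s) K (d + e) ⧸ gradedPiece I (d + e) :=
  (gradedPiece I (d + e)).mkQ ∘ₗ
    ((LinearMap.mulRight K f).domRestrict (homogeneousSubmodule (Fin s) K d)).codRestrict
      (homogeneousSubmodule (Fin s) K (d + e)) fun x => x.2.mul hf

/-- Dimension count in the exact sequence `0 → (S/(I:f))(-e) → S/I → S/(I,f) → 0`. -/
theorem hilbertFn_add {I : Ideal (MvPolynomial (Fin s) K)} (hI : IsGraded I)
    {f : MvPolynomial (Fin s) K} {e : ℕ} (hf : f.IsHomogeneous e) (d : ℕ) :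
    hilbertFn I (d + e) = hilbertFn (I.colon {f}) d + hilbertFn (I ⊔ Ideal.span {f}) (d + e) := by
  have hker : LinearMap.ker (mulForm I hf d) = gradedPiece (I.colon {f}) d := by
    ext x
    rw [LinearMap.mem_ker, mem_gradedPiece, mem_colon_iff, mulForm, LinearMap.comp_apply,
      Submodule.mkQ_apply, Submodule.Quotient.mk_eq_zero]
    rfl
  have hle : gradedPiece I (d + e) ≤ gradedPiece (I ⊔ Ideal.span {f}) (d + e) :=
    fun x hx => (le_sup_left : I ≤ I ⊔ Ideal.span {f}) hx
  have hrange : LinearMap.ker (Submodule.factor hle) = LinearMap.range (mulForm I hf d) := by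
    ext y
    obtain ⟨x, rfl⟩ := Submodule.mkQ_surjective _ y
    rw [LinearMap.mem_ker, Submodule.factor_mk, Submodule.mkQ_apply, Submodule.mkQ_apply,
      Submodule.Quotient.mk_eq_zero,
      mem_gradedPiece, LinearMap.mem_range]
    constructor
    · intro hx
      obtain ⟨i, hi, j, hj, hij⟩ := Submodule.mem_sup.1 hx
      obtain ⟨g, rfl⟩ := Ideal.mem_span_singleton'.1 hj
      -- The cofactor `g` need not be homogeneous; only its degree `d` part contributes in degree `d
      -- + e`.
      refine ⟨⟨homogeneousComponent d g, homogeneousComponent_mem d g⟩, ?_⟩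
      rw [mulForm, LinearMap.comp_apply, Submodule.mkQ_apply, Submodule.Quotient.eq,
        mem_gradedPiece]
      have h1 : homogeneousComponent (d + e) (x : MvPolynomial (Fin s) K) = x :=
        homogeneousComponent_eq_self x.2
      rw [← hij, map_add, homogeneousComponent_mul_of_right hf, hij] at h1
      have h2 : (homogeneousComponent d g * f - (x : MvPolynomial (Fin s) K)) ∈ I := by
        rw [← h1]
        simpa using hI _ hi (d + e)
      exact h2
    · rintro ⟨z, hz⟩
      rw [mulForm, LinearMap.comp_apply, Submodule.mkQ_apply, Submodule.Quotient.eq,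
        mem_gradedPiece] at hz
      have hz' : (z : MvPolynomial (Fin s) K) * f - x ∈ I := hz
      have h3 : (z : MvPolynomial (Fin s) K) * f ∈ I ⊔ Ideal.span {f} :=
        (le_sup_right : Ideal.span {f} ≤ _)
          (Ideal.mul_mem_left _ _ (Ideal.mem_span_singleton_self f))
      have h4 := Ideal.sub_mem _ h3 ((le_sup_left : I ≤ I ⊔ Ideal.span {f}) hz')
      simpa using h4
  have h1 := LinearMap.finrank_range_add_finrank_ker (Submodule.factor hle)
  rw [LinearMap.range_eq_top.2 (Submodule.factor_surjective hle), finrank_top, hrange,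
    ← (LinearMap.quotKerEquivRange (mulForm I hf d)).finrank_eq, hker] at h1
  exact h1.symm.trans (add_comm _ _)

end Graded

/-! ### Heights and Krull dimensions in polynomial rings -/

section Dimension

/-- Extension to `R[x]` is strictly monotone on primes, so it carries chains below `p` to chains
below its extension. -/
theorem height_le_height_map_C {R : Type*} [CommRing R] (p : Ideal R) [hp : p.IsPrime] :
    p.height ≤ (p.map (Polynomial.C : R →+* Polynomial R)).height := by
  let F : PrimeSpectrum R → PrimeSpectrum (Polynomial R) := fun q =>
    ⟨q.asIdeal.map Polynomial.C, Ideal.isPrime_map_C_of_isPrime⟩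
  have hcomap : ∀ q : Ideal R, (q.map Polynomial.C).comap (Polynomial.C : R →+* Polynomial R) = q := by
    intro q
    ext x
    rw [Ideal.mem_comap, Ideal.mem_map_C_iff]
    refine ⟨fun h => by simpa using h 0, fun h n => ?_⟩
    rw [Polynomial.coeff_C]
    split_ifs
    · exact h
    · exact q.zero_mem
  have hF : StrictMono F := by
    refine Monotone.strictMono_of_injective (fun a b hab => Ideal.map_mono hab) fun a b hab => ?_
    have h1 : a.asIdeal.map Polynomial.C = b.asIdeal.map Polynomial.C :=
      congrArg PrimeSpectrum.asIdeal hab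
    exact PrimeSpectrum.ext (by rw [← hcomap a.asIdeal, h1, hcomap])
  have h := Order.height_le_height_apply_of_strictMono F hF ⟨p, hp⟩
  rwa [← PrimeSpectrum.height_eq_orderHeight, ← PrimeSpectrum.height_eq_orderHeight] at h

variable {K : Type u} [Field K]

theorem finSuccEquiv_rename_cons {n r : ℕ} (φ : Fin r → Fin n) (f : MvPolynomial (Fin (r + 1)) K) :
    finSuccEquiv K n (rename (Fin.cons 0 (Fin.succ ∘ φ)) f) =
      Polynomial.map (rename φ : MvPolynomial (Fin r) K →ₐ[K] MvPolynomial (Fin n) K).toRingHom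
        (finSuccEquiv K r f) := by
  induction f using MvPolynomial.induction_on with
  | C a => simp [finSuccEquiv_apply]
  | add p q hp hq => simp only [map_add, hp, hq, Polynomial.map_add]
  | mul_X p i hp =>
    simp only [map_mul, hp, Polynomial.map_mul]
    congr 1
    refine Fin.cases ?_ (fun j => ?_) i
    · simp [finSuccEquiv_X_zero]
    · simp [finSuccEquiv_X_succ]

theorem finSuccEquiv_rename_succ {n r : ℕ} (φ : Fin r → Fin n) (f : MvPolynomial (Fin r) K) :
    finSuccEquiv K n (rename (Fin.succ ∘ φ) f) = Polynomial.C (rename φ f) := by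
  induction f using MvPolynomial.induction_on with
  | C a => simp [finSuccEquiv_apply]
  | add p q hp hq => simp only [map_add, hp, hq]
  | mul_X p i hp => simp [hp, finSuccEquiv_X_succ]

/-- A prime of height `h` in a polynomial ring in `n` variables meets the polynomial ring in some
`r ≥ n - h` of the variables trivially. -/
theorem exists_rename_injective_mod (n : ℕ) (P : Ideal (MvPolynomial (Fin n) K)) [P.IsPrime] :
    ∃ (r : ℕ) (φ : Fin r → Fin n), Function.Injective φ ∧ (n : ℕ∞) ≤ r + P.height ∧
      ∀ f, rename φ f ∈ P → f = 0 := by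
  induction n with
  | zero =>
    refine ⟨0, id, Function.injective_id, by simp, fun f hf => ?_⟩
    by_contra hne
    rw [rename_id_apply, eq_C_of_isEmpty f] at hf
    have hc : coeff 0 f ≠ 0 := fun h0 => hne (by rw [eq_C_of_isEmpty f, h0, C_0])
    exact ‹P.IsPrime›.ne_top (Ideal.eq_top_of_isUnit_mem _ hf (hc.isUnit.map C))
  | succ n ih =>
    let e := (finSuccEquiv K n).toRingEquiv
    set Q : Ideal (Polynomial (MvPolynomial (Fin n) K)) := P.comap e.symm with hQ
    have hQP : Q.height = P.height := e.symm.height_comap P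
    set p := Q.comap (Polynomial.C : MvPolynomial (Fin n) K →+* _) with hp
    obtain ⟨r, φ, hφ, hle, hinj⟩ := ih p
    have hmem : ∀ f, f ∈ P ↔ finSuccEquiv K n f ∈ Q := by
      intro f
      rw [hQ, Ideal.mem_comap]
      change f ∈ P ↔ (finSuccEquiv K n).symm (finSuccEquiv K n f) ∈ P
      rw [AlgEquiv.symm_apply_apply]
    have hmap : p.map Polynomial.C ≤ Q := Ideal.map_comap_le
    -- If `Q` is extended from `p`, the new variable is free modulo `P` and joins the list;
    -- otherwise the height rises by at least one, which pays for the omitted variable.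
    rcases hmap.eq_or_lt with heq | hlt
    · refine ⟨r + 1, Fin.cons 0 (Fin.succ ∘ φ), ?_, ?_, fun f hf => ?_⟩
      · rw [Fin.cons_injective_iff]
        refine ⟨?_, (Fin.succ_injective n).comp hφ⟩
        rintro ⟨j, hj⟩
        exact Fin.succ_ne_zero _ hj
      · have h1 := height_le_height_map_C p
        rw [heq, hQP] at h1
        calc ((n + 1 : ℕ) : ℕ∞) = n + 1 := by push_cast; rfl
          _ ≤ r + p.height + 1 := by gcongr
          _ ≤ r + P.height + 1 := by gcongr
          _ = ((r + 1 : ℕ) : ℕ∞) + P.height := by push_cast; ring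
      · rw [hmem, finSuccEquiv_rename_cons, ← heq, Ideal.mem_map_C_iff] at hf
        apply (finSuccEquiv K r).injective
        rw [map_zero]
        ext1 i
        rw [Polynomial.coeff_zero]
        refine hinj _ ?_
        have := hf i
        rwa [Polynomial.coeff_map] at this
    · refine ⟨r, Fin.succ ∘ φ, (Fin.succ_injective n).comp hφ, ?_, fun f hf => ?_⟩
      · have h1 := Ideal.height_add_one_le_of_lt_of_isPrime hlt
        have h2 := height_le_height_map_C p
        rw [hQP] at h1
        calc ((n + 1 : ℕ) : ℕ∞) = n + 1 := by push_cast; rfl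
          _ ≤ r + p.height + 1 := by gcongr
          _ ≤ r + (p.map Polynomial.C).height + 1 := by gcongr
          _ = r + ((p.map Polynomial.C).height + 1) := add_assoc _ _ _
          _ ≤ r + P.height := by gcongr
      · rw [hmem, finSuccEquiv_rename_succ] at hf
        exact hinj _ hf

variable {s : ℕ}

theorem ringKrullDim_mvPolynomial_field :
    ringKrullDim (MvPolynomial (Fin s) K) = (s : WithBot ℕ∞) := by
  rw [MvPolynomial.ringKrullDim_of_isNoetherianRing, ringKrullDim_eq_zero_of_field]
  simp

theorem coe_dim {I : Ideal (MvPolynomial (Fin s) K)} (hI : I ≠ ⊤) :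
    ((dim I : ℕ) : WithBot ℕ∞) = ringKrullDim (MvPolynomial (Fin s) K ⧸ I) := by
  have : Nontrivial (MvPolynomial (Fin s) K ⧸ I) := Ideal.Quotient.nontrivial_iff.2 hI
  have h0 := ringKrullDim_nonneg_of_nontrivial (R := MvPolynomial (Fin s) K ⧸ I)
  have h1 := ringKrullDim_quotient_le I
  rw [ringKrullDim_mvPolynomial_field] at h1
  unfold dim
  generalize ringKrullDim (MvPolynomial (Fin s) K ⧸ I) = x at h0 h1 ⊢
  induction x using WithBot.recBotCoe with
  | bot => simp at h0
  | coe x =>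
    have hx : x ≤ s := by exact_mod_cast h1
    have hx' : x ≠ ⊤ := ne_top_of_le_ne_top (ENat.natCast_ne_top s) hx
    rw [WithBot.unbotD_coe]
    have := ENat.natCast_toNat hx'
    conv_rhs => rw [← this]
    rfl

theorem dim_top : dim (⊤ : Ideal (MvPolynomial (Fin s) K)) = 0 := by
  have : Subsingleton (MvPolynomial (Fin s) K ⧸ (⊤ : Ideal (MvPolynomial (Fin s) K))) :=
    Ideal.Quotient.subsingleton_iff.2 rfl
  rw [dim, ringKrullDim_eq_bot_of_subsingleton]
  rfl

theorem dim_anti {I J : Ideal (MvPolynomial (Fin s) K)} (h : I ≤ J) : dim J ≤ dim I := by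
  by_cases hJ : J = ⊤
  · rw [hJ, dim_top]; exact Nat.zero_le _
  have hI : I ≠ ⊤ := fun hI => hJ (top_le_iff.1 (hI ▸ h))
  have := ringKrullDim_le_of_surjective (Ideal.Quotient.factor h) (Ideal.Quotient.factor_surjective h)
  rw [← coe_dim hI, ← coe_dim hJ] at this
  exact_mod_cast this

theorem coe_dim_eq_coheight (P : PrimeSpectrum (MvPolynomial (Fin s) K)) :
    ((dim P.asIdeal : ℕ) : ℕ∞) = Order.coheight P := by
  have h1 := coe_dim P.2.ne_top
  have h2 : (PrimeSpectrum.zeroLocus (P.asIdeal : Set (MvPolynomial (Fin s) K))) = Set.Ici P := by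
    ext x; rfl
  rw [ringKrullDim_quotient, h2, ← Order.coheight_eq_krullDim_Ici] at h1
  exact_mod_cast h1

theorem height_add_dim_le (P : Ideal (MvPolynomial (Fin s) K)) [hP : P.IsPrime] :
    P.height + (dim P : ℕ∞) ≤ s := by
  have h := coe_dim_eq_coheight ⟨P, hP⟩
  have h1 := PrimeSpectrum.height_eq_orderHeight (⟨P, hP⟩ : PrimeSpectrum (MvPolynomial (Fin s) K))
  simp only at h h1
  rw [h, h1]
  have h2 : ringKrullDim (MvPolynomial (Fin s) K) = _ := Order.krullDim_eq_iSup_height_add_coheight_of_nonempty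
  rw [ringKrullDim_mvPolynomial_field] at h2
  have h3 : (s : ℕ∞) = ⨆ a : PrimeSpectrum (MvPolynomial (Fin s) K),
      Order.height a + Order.coheight a := by exact_mod_cast h2
  rw [h3]
  exact le_iSup (fun a : PrimeSpectrum (MvPolynomial (Fin s) K) =>
    Order.height a + Order.coheight a) ⟨P, hP⟩

theorem dim_add_one_le_of_lt {P Q : Ideal (MvPolynomial (Fin s) K)} [hP : P.IsPrime]
    [hQ : Q.IsPrime] (h : P < Q) : dim Q + 1 ≤ dim P := by
  have := Order.coheight_add_one_le (a := (⟨Q, hQ⟩ : PrimeSpectrum (MvPolynomial (Fin s) K)))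
    (b := ⟨P, hP⟩) h
  rw [← coe_dim_eq_coheight, ← coe_dim_eq_coheight] at this
  exact_mod_cast this

/-- A longest chain of primes above `I` starts above some minimal prime, which therefore has the
full dimension. -/
theorem exists_minimalPrimes_dim_eq {I : Ideal (MvPolynomial (Fin s) K)} (hI : I ≠ ⊤) :
    ∃ q ∈ I.minimalPrimes, dim q = dim I := by
  have h1 := coe_dim hI
  rw [ringKrullDim_quotient] at h1
  obtain ⟨l, hl⟩ := Order.le_krullDim_iff.1 h1.le
  obtain ⟨q, hq, hqx⟩ := Ideal.exists_minimalPrimes_le (J := l.head.1.asIdeal) (I := I) l.head.2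
  refine ⟨q, hq, le_antisymm (dim_anti hq.1.2) ?_⟩
  let l' : LTSeries (PrimeSpectrum (MvPolynomial (Fin s) K)) :=
    l.map Subtype.val fun _ _ h => h
  have h2 := Order.length_le_coheight (x := (⟨q, hq.1.1⟩ : PrimeSpectrum _)) (p := l') hqx
  rw [← coe_dim_eq_coheight] at h2
  have h3 : l'.length = dim I := hl
  rw [h3] at h2
  exact_mod_cast h2

theorem dim_sup_span_add_one_le {P : Ideal (MvPolynomial (Fin s) K)} [P.IsPrime]
    {x : MvPolynomial (Fin s) K} (hx : x ∉ P) (h : P ⊔ Ideal.span {x} ≠ ⊤) :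
    dim (P ⊔ Ideal.span {x}) + 1 ≤ dim P := by
  obtain ⟨q, hq, hqd⟩ := exists_minimalPrimes_dim_eq h
  have := hq.1.1
  rw [← hqd]
  refine dim_add_one_le_of_lt (lt_of_le_of_ne (le_sup_left.trans hq.1.2) ?_)
  rintro rfl
  exact hx (hq.1.2 (Ideal.mem_sup_right (Ideal.mem_span_singleton_self x)))

theorem le_colon_singleton (I : Ideal (MvPolynomial (Fin s) K)) (f : MvPolynomial (Fin s) K) :
    I ≤ I.colon {f} := fun g hg => by
  simpa using I.mul_mem_right f hg

/-- A minimal prime of full dimension either contains `f`, hence `(I, f)`, or omits `f` and then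
contains `(I : f)`. -/
theorem dim_eq_max (I : Ideal (MvPolynomial (Fin s) K)) (f : MvPolynomial (Fin s) K) :
    dim I = max (dim (I.colon {f})) (dim (I ⊔ Ideal.span {f})) := by
  refine le_antisymm ?_ (max_le (dim_anti (le_colon_singleton I f)) (dim_anti le_sup_left))
  by_cases hI : I = ⊤
  · rw [hI, dim_top]; exact Nat.zero_le _
  obtain ⟨q, hq, hqd⟩ := exists_minimalPrimes_dim_eq hI
  rw [← hqd, le_max_iff]
  by_cases hf : f ∈ q
  · right
    refine dim_anti (sup_le hq.1.2 ?_)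
    rwa [Ideal.span_singleton_le_iff_mem]
  · left
    refine dim_anti fun g hg => ?_
    have h1 : g * f ∈ I := by simpa using hg
    exact (hq.1.1.mem_or_mem (hq.1.2 h1)).resolve_right hf

end Dimension

/-! ### Growth of the Hilbert function, and the degree as an eventual difference -/

section HilbertFunction

variable {K : Type u} [Field K] {s : ℕ}

/-- The monomials of degree `d` in the `r` chosen variables stay linearly independent modulo `P`. -/
theorem multichoose_le_hilbertFn {P : Ideal (MvPolynomial (Fin s) K)} {r : ℕ} {φ : Fin r → Fin s}
    (h : ∀ f : MvPolynomial (Fin r) K, rename φ f ∈ P → f = 0) (d : ℕ) :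
    Nat.multichoose r d ≤ hilbertFn P d := by
  let T := (Finset.univ : Finset (Fin r)).finsuppAntidiag d
  have hdeg : ∀ a : T, Finsupp.degree a.1 = d := fun a => by
    have := (Finset.mem_finsuppAntidiag.1 a.2).1
    rwa [Finsupp.degree_eq_sum]
  let v : T → homogeneousSubmodule (Fin r) K d :=
    fun a => ⟨monomial a.1 1, isHomogeneous_monomial 1 (hdeg a)⟩
  have hv : LinearIndependent K v := by
    have h1 := (basisMonomials (Fin r) K).linearIndependent.comp (fun a : T => a.1)
      Subtype.val_injective
    refine LinearIndependent.of_comp (homogeneousSubmodule (Fin r) K d).subtype ?_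
    have h2 : (homogeneousSubmodule (Fin r) K d).subtype ∘ v =
        basisMonomials (Fin r) K ∘ fun a : T => a.1 := by
      funext a
      simp [v]
    rw [h2]
    exact h1
  let L : homogeneousSubmodule (Fin r) K d →ₗ[K]
      homogeneousSubmodule (Fin s) K d ⧸ gradedPiece P d :=
    (gradedPiece P d).mkQ ∘ₗ
      (((rename φ).toLinearMap).domRestrict (homogeneousSubmodule (Fin r) K d)).codRestrict
        (homogeneousSubmodule (Fin s) K d) fun x => IsHomogeneous.rename_isHomogeneous x.2
  have hL : LinearMap.ker L = ⊥ := by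
    rw [LinearMap.ker_eq_bot']
    intro x hx
    rw [LinearMap.comp_apply, Submodule.mkQ_apply, Submodule.Quotient.mk_eq_zero] at hx
    exact Subtype.ext (h x hx)
  have h2 := (hv.map' L hL).fintype_card_le_finrank
  have h3 : Fintype.card T = Nat.multichoose r d := by
    rw [Fintype.card_coe, Finset.card_finsuppAntidiag_nat_eq_multichoose, Finset.card_univ,
      Fintype.card_fin]
  rwa [h3] at h2

theorem mem_of_X_mem {I : Ideal (MvPolynomial (Fin s) K)} (hX : ∀ i, X i ∈ I)
    {f : MvPolynomial (Fin s) K} {d : ℕ} (hd : 1 ≤ d) (hf : f.IsHomogeneous d) : f ∈ I := by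
  rw [f.as_sum]
  refine I.sum_mem fun a ha => ?_
  have h1 : Finsupp.degree a = d := hf.degree_eq_sum_deg_support ha ▸ rfl
  have h2 : a ≠ 0 := by
    rintro rfl
    simp at h1
    omega
  obtain ⟨i, hi⟩ := Finsupp.ne_iff.1 h2
  have h3 : (X i : MvPolynomial (Fin s) K) ∣ monomial a (coeff a f) := by
    rw [X_dvd_monomial]
    exact Or.inr hi
  exact I.mem_of_dvd h3 (hX i)

theorem IsGraded.sup_span_ne_top {I : Ideal (MvPolynomial (Fin s) K)} (hI : IsGraded I)
    (htop : I ≠ ⊤) {f : MvPolynomial (Fin s) K} {e : ℕ} (he : 1 ≤ e) (hf : f.IsHomogeneous e) :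
    I ⊔ Ideal.span {f} ≠ ⊤ := by
  intro h
  have h1 : (1 : MvPolynomial (Fin s) K) ∈ I ⊔ Ideal.span {f} := by rw [h]; trivial
  obtain ⟨i, hi, j, hj, hij⟩ := Submodule.mem_sup.1 h1
  obtain ⟨g, rfl⟩ := Ideal.mem_span_singleton'.1 hj
  have h2 : homogeneousComponent 0 (g * f) = 0 := by
    have hf0 : coeff 0 f = 0 := hf.coeff_eq_zero (by simp; omega)
    rw [homogeneousComponent_zero, ← constantCoeff_eq, map_mul, constantCoeff_eq, hf0, mul_zero,
      C_0]
  have h3 := congrArg (homogeneousComponent 0) hij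
  rw [map_add, h2, add_zero, homogeneousComponent_eq_self (isHomogeneous_one _ _)] at h3
  exact htop ((Ideal.eq_top_iff_one _).2 (h3 ▸ hI i hi 0))

theorem colon_eq_self_of_isPrime {P : Ideal (MvPolynomial (Fin s) K)} (hP : P.IsPrime)
    {f : MvPolynomial (Fin s) K} (hf : f ∉ P) : P.colon {f} = P :=
  le_antisymm (fun _ hg => (hP.mem_or_mem (mem_colon_iff.1 hg)).resolve_right hf)
    (le_colon_singleton P f)

/-- If the Hilbert functions of all larger graded ideals grow according to the Krull dimension,
then so does the one of a graded prime, and the dimension formula holds. -/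
theorem hasHilbertDim_of_isPrime {P : Ideal (MvPolynomial (Fin s) K)} (hP : P.IsPrime)
    (hgr : IsGraded P)
    (ih : ∀ J, P < J → IsGraded J → HasHilbertDim (hilbertFn J) (dim J)) :
    HasHilbertDim (hilbertFn P) (dim P) ∧ P.height + (dim P : ℕ∞) = s := by
  obtain ⟨r, φ, -, hr, hinj⟩ := exists_rename_injective_mod s P
  have hle := height_add_dim_le P
  have hfin : P.height ≠ ⊤ := by
    intro h
    rw [h, top_add, top_le_iff] at hle
    exact ENat.natCast_ne_top s hle
  obtain ⟨t, ht⟩ := ENat.ne_top_iff_exists.1 hfin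
  rw [← ht] at hr hle ⊢
  norm_cast at hr hle ⊢
  -- An upper bound for the growth suffices: `dim P ≤ s - t ≤ r ≤ k ≤ dim P`, with `t` the height,
  -- closes up and yields the dimension formula as well.
  suffices h : ∃ k, HasHilbertDim (hilbertFn P) k ∧ k ≤ dim P by
    obtain ⟨k, hk, hkd⟩ := h
    have h1 := (hasHilbertDim_multichoose r).mono hk (multichoose_le_hilbertFn hinj)
    obtain rfl : k = dim P := by omega
    exact ⟨hk, by omega⟩
  by_cases hX : ∀ i, X i ∈ P
  · refine ⟨0, Or.inl ⟨rfl, ?_⟩, Nat.zero_le _⟩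
    filter_upwards [eventually_ge_atTop 1] with d hd
    have := hilbertFn_eq_zero fun f hf => mem_of_X_mem hX hd hf
    simp [this]
  · push Not at hX
    obtain ⟨i, hi⟩ := hX
    have hXi : (X i : MvPolynomial (Fin s) K).IsHomogeneous 1 := isHomogeneous_X _ _
    have htop := hgr.sup_span_ne_top hP.ne_top le_rfl hXi
    have hlt : P < P ⊔ Ideal.span {X i} := by
      refine lt_of_le_of_ne le_sup_left fun h => hi ?_
      rw [h]
      exact Ideal.mem_sup_right (Ideal.mem_span_singleton_self _)
    refine ⟨dim (P ⊔ Ideal.span {X i}) + 1, HasHilbertDim.integrate (fun d => ?_)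
      (ih _ hlt (hgr.sup_span hXi)) fun h0 => ?_, dim_sup_span_add_one_le hi htop⟩
    · have := hilbertFn_add hgr hXi d
      rwa [colon_eq_self_of_isPrime hP hi] at this
    -- A vanishing value `hilbertFn P d` would put `X i ^ d` into `P`.
    · obtain ⟨d, hd⟩ := Filter.Eventually.exists h0
      have h1 : hilbertFn P d = 0 := by simpa using hd
      exact hi (hP.mem_of_pow_mem d (mem_of_hilbertFn_eq_zero h1 (by simpa using hXi.pow d)))

/-- The Hilbert function of `S/I` is eventually a polynomial function of degree `dim (S/I) - 1`. -/
theorem hasHilbertDim_hilbertFn (I : Ideal (MvPolynomial (Fin s) K)) (hI : IsGraded I) :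
    HasHilbertDim (hilbertFn I) (dim I) := by
  induction I using IsWellFounded.induction (· > · : Ideal (MvPolynomial (Fin s) K) → _ → Prop) with
  | ind I ih =>
  by_cases htop : I = ⊤
  · subst htop
    rw [dim_top]
    refine Or.inl ⟨rfl, Eventually.of_forall fun d => ?_⟩
    have : hilbertFn (⊤ : Ideal (MvPolynomial (Fin s) K)) d = 0 := hilbertFn_eq_zero fun _ _ => trivial
    simp [this]
  by_cases hP : I.IsPrime
  · exact (hasHilbertDim_of_isPrime hP hI fun J hJ hJg => ih J hJ hJg).1
  obtain ⟨f, g, e, hf, hfI, hgI, hfg⟩ := hI.exists_of_not_isPrime htop hP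
  -- Both `(I : f)` and `(I, f)` are strictly larger than `I`, the former because it contains `g`.
  rw [dim_eq_max I f]
  refine HasHilbertDim.add (hilbertFn_add hI hf) (ih _ ?_ (hI.colon hf)) (ih _ ?_ (hI.sup_span hf))
  · refine lt_of_le_of_ne (le_colon_singleton I f) fun h => hgI ?_
    rw [h, mem_colon_iff]
    exact hfg
  · refine lt_of_le_of_ne le_sup_left fun h => hfI ?_
    rw [h]
    exact Ideal.mem_sup_right (Ideal.mem_span_singleton_self _)

theorem height_add_dim {P : Ideal (MvPolynomial (Fin s) K)} (hP : P.IsPrime) (hgr : IsGraded P) :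
    P.height + (dim P : ℕ∞) = s :=
  (hasHilbertDim_of_isPrime hP hgr fun J _ hJ => hasHilbertDim_hilbertFn J hJ).2

/-- For graded ideals with `dim (S/I) = k + 1`, the degree is the eventual value of the `k`-th
difference of the Hilbert function. -/
theorem hasDiff_degree {I : Ideal (MvPolynomial (Fin s) K)} (hI : IsGraded I) {k : ℕ}
    (hk : dim I = k + 1) : HasDiff (hilbertFn I) k (degree I) ∧ 0 < degree I := by
  have h := hasHilbertDim_hilbertFn I hI
  rw [hk] at h
  obtain ⟨e, he, h⟩ := h.exists_hasDiff
  have hset : {n : ℕ | Tendsto (fun d : ℕ => ((dim I - 1).factorial : ℝ) *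
      ((hilbertFn I d : ℝ) / (d : ℝ) ^ (dim I - 1))) atTop (𝓝 (n : ℝ))} = {e.toNat} := by
    ext n
    rw [Set.mem_ofPred_eq, hk, Nat.add_sub_cancel, Set.mem_singleton_iff]
    constructor
    · intro hn
      have : (n : ℝ) = (e : ℝ) := tendsto_nhds_unique hn h.tendsto
      have : (n : ℤ) = e := by exact_mod_cast this
      omega
    · rintro rfl
      convert h.tendsto using 2
      have : ((e.toNat : ℤ) : ℝ) = (e : ℝ) := by rw [Int.toNat_of_nonneg he.le]
      exact_mod_cast this
  have hdeg : degree I = e.toNat := by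
    rw [degree, if_pos (by omega), hset, csInf_singleton]
  rw [hdeg, Int.toNat_of_nonneg he.le]
  exact ⟨h, by omega⟩

theorem degree_le_degree {I J : Ideal (MvPolynomial (Fin s) K)} (hI : IsGraded I)
    (hJ : IsGraded J) (hdim : dim I = dim J) (hpos : 1 ≤ dim J)
    (h : ∀ d, hilbertFn I d ≤ hilbertFn J d) : degree I ≤ degree J := by
  obtain ⟨k, hk⟩ : ∃ k, dim J = k + 1 := ⟨dim J - 1, by omega⟩
  have := (hasDiff_degree hI (hdim.trans hk)).1.mono (hasDiff_degree hJ hk).1 h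
  exact_mod_cast this

theorem degree_eq_add {I : Ideal (MvPolynomial (Fin s) K)} (hI : IsGraded I)
    {f : MvPolynomial (Fin s) K} {e : ℕ} (hf : f.IsHomogeneous e) (hpos : 1 ≤ dim I)
    (h1 : dim (I.colon {f}) = dim I) (h2 : dim (I ⊔ Ideal.span {f}) = dim I) :
    degree I = degree (I.colon {f}) + degree (I ⊔ Ideal.span {f}) := by
  obtain ⟨k, hk⟩ : ∃ k, dim I = k + 1 := ⟨dim I - 1, by omega⟩
  have h := HasDiff.add (hilbertFn_add hI hf) (hasDiff_degree (hI.colon hf) (h1.trans hk)).1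
    (hasDiff_degree (hI.sup_span hf) (h2.trans hk)).1
  have := (hasDiff_degree hI hk).1.unique h
  exact_mod_cast this

theorem degree_top : degree (⊤ : Ideal (MvPolynomial (Fin s) K)) = 0 := by
  have : Subsingleton (MvPolynomial (Fin s) K ⧸ (⊤ : Ideal (MvPolynomial (Fin s) K))) :=
    Ideal.Quotient.subsingleton_iff.2 rfl
  rw [degree, dim_top, if_neg (by omega)]
  exact Module.finrank_zero_of_subsingleton

end HilbertFunction

/-! ### Standard monomials, initial ideals and Hilbert functions -/

section Footprint

variable {K : Type u} [Field K] {s : ℕ} (m : MonomialOrder.{0, v} (Fin s))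

/-- Cancelling the leading term. -/
theorem exists_sub_smul_degree_lt {x z : MvPolynomial (Fin s) K} (hz : z ≠ 0)
    (h : m.degree x = m.degree z) :
    ∃ c : K, x - c • z = 0 ∨ m.toSyn (m.degree (x - c • z)) < m.toSyn (m.degree x) := by
  have hzc : m.leadingCoeff z ≠ 0 := m.leadingCoeff_ne_zero_iff.2 hz
  refine ⟨m.leadingCoeff x / m.leadingCoeff z, or_iff_not_imp_left.2 fun hne => ?_⟩
  set y := x - (m.leadingCoeff x / m.leadingCoeff z) • z with hy
  have hle : m.toSyn (m.degree y) ≤ m.toSyn (m.degree x) := by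
    refine (m.degree_sub_le).trans (sup_le le_rfl ?_)
    rw [h]
    exact m.degree_smul_le
  refine lt_of_le_of_ne hle fun heq => hne ?_
  have heq' : m.degree y = m.degree x := m.toSyn.injective heq
  rw [← m.coeff_degree_eq_zero_iff, heq', hy, coeff_sub, coeff_smul, smul_eq_mul]
  nth_rw 2 [h]
  change m.leadingCoeff x - m.leadingCoeff x / m.leadingCoeff z * m.leadingCoeff z = 0
  rw [div_mul_cancel₀ _ hzc, sub_self]

/-- The homogeneous component that contains the leading monomial of an element of `J` lies in `J`
and has the same leading monomial. -/
theorem IsGraded.exists_homogeneous_degree_eq {J : Ideal (MvPolynomial (Fin s) K)}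
    (hJ : IsGraded J) {a : Fin s →₀ ℕ} (ha : a ∉ footprint m J) :
    ∃ z ∈ J, z ≠ 0 ∧ z.IsHomogeneous (Finsupp.degree a) ∧ m.degree z = a := by
  obtain ⟨g, hg, hg0, rfl⟩ : ∃ f ∈ J, f ≠ 0 ∧ m.degree f = a := by
    by_contra h
    exact ha h
  set d := Finsupp.degree (m.degree g)
  have hcoeff : coeff (m.degree g) (homogeneousComponent d g) ≠ 0 := by
    rw [coeff_homogeneousComponent, if_pos rfl]
    exact m.leadingCoeff_ne_zero_iff.2 hg0
  refine ⟨homogeneousComponent d g, hJ g hg d, fun h => hcoeff (by rw [h, coeff_zero]),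
    homogeneousComponent_isHomogeneous d g, m.toSyn.injective (le_antisymm ?_ ?_)⟩
  · refine m.degree_le_degree_of_support_subset fun b hb => ?_
    rw [mem_support_iff, coeff_homogeneousComponent] at hb
    rw [mem_support_iff]
    split_ifs at hb
    · exact hb
    · exact absurd rfl hb
  · exact m.le_degree (mem_support_iff.2 hcoeff)

theorem degree_degree_eq {x : MvPolynomial (Fin s) K} {d : ℕ} (hx : x.IsHomogeneous d)
    (h0 : x ≠ 0) : Finsupp.degree (m.degree x) = d := by
  by_contra h
  exact m.coeff_degree_ne_zero_iff.2 h0 (hx.coeff_eq_zero h)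

/-- A form outside `J` is congruent modulo `J` to a form with standard leading monomial. -/
theorem IsGraded.exists_standard_form {J : Ideal (MvPolynomial (Fin s) K)} (hJ : IsGraded J)
    {f : MvPolynomial (Fin s) K} {d : ℕ} (hf : f.IsHomogeneous d) (hfJ : f ∉ J) :
    ∃ g, g.IsHomogeneous d ∧ g ≠ 0 ∧ f - g ∈ J ∧ m.degree g ∈ footprintDeg m J d := by
  -- The required form is one with the smallest leading monomial among the forms of degree `d`
  -- congruent to `f`; a nonstandard leading monomial could be cancelled.
  have hwf := InvImage.wf (fun g : MvPolynomial (Fin s) K => m.toSyn (m.degree g)) m.wellFoundedLT_syn.wf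
  obtain ⟨g, ⟨hg, hgJ⟩, hmin⟩ := hwf.has_min {g | g.IsHomogeneous d ∧ f - g ∈ J}
    ⟨f, hf, by simp⟩
  have hg0 : g ≠ 0 := by
    rintro rfl
    exact hfJ (by simpa using hgJ)
  have hdeg := degree_degree_eq m hg hg0
  refine ⟨g, hg, hg0, hgJ, ?_, hdeg⟩
  by_contra hst
  obtain ⟨z, hzJ, hz0, hz, hza⟩ := hJ.exists_homogeneous_degree_eq m hst
  rw [hdeg] at hz
  obtain ⟨c, hc⟩ := exists_sub_smul_degree_lt m hz0 hza.symm
  have hczJ : c • z ∈ J := by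
    rw [smul_eq_C_mul]
    exact J.mul_mem_left _ hzJ
  have hy : f - (g - c • z) ∈ J := by
    have := J.add_mem hgJ hczJ
    rwa [show f - (g - c • z) = f - g + c • z by ring]
  have hyh : (g - c • z).IsHomogeneous d :=
    hg.sub ((homogeneousSubmodule (Fin s) K d).smul_mem c hz)
  rcases hc with hc | hc
  · rw [hc, sub_zero] at hy
    exact hfJ hy
  · exact hmin _ ⟨hyh, hy⟩ hc

/-- The standard monomials of degree `d`, as elements of `S_d`. -/
def standardMonomial (J : Ideal (MvPolynomial (Fin s) K)) (d : ℕ) (a : footprintDeg m J d) :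
    homogeneousSubmodule (Fin s) K d :=
  ⟨monomial a.1 1, isHomogeneous_monomial 1 a.2.2⟩

/-- A nonzero combination of standard monomials has a standard leading monomial, so it is not in
`J`. -/
theorem linearIndependent_standardMonomial (J : Ideal (MvPolynomial (Fin s) K)) (d : ℕ) :
    LinearIndependent K ((gradedPiece J d).mkQ ∘ standardMonomial m J d) := by
  have h1 : LinearIndependent K (standardMonomial m J d) := by
    refine LinearIndependent.of_comp (homogeneousSubmodule (Fin s) K d).subtype ?_
    have h2 : (homogeneousSubmodule (Fin s) K d).subtype ∘ standardMonomial m J d =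
        basisMonomials (Fin s) K ∘ fun a : footprintDeg m J d => a.1 := by
      funext a
      simp [standardMonomial]
    rw [h2]
    exact (basisMonomials (Fin s) K).linearIndependent.comp _ Subtype.val_injective
  refine h1.map ?_
  rw [Submodule.disjoint_def]
  intro x hx hxJ
  rw [Submodule.ker_mkQ, mem_gradedPiece] at hxJ
  have hsupp : ∀ b ∉ footprint m J, coeff b (x : MvPolynomial (Fin s) K) = 0 := by
    clear hxJ
    intro b hb
    induction hx using Submodule.span_induction with
    | mem y hy =>
      obtain ⟨a, rfl⟩ := hy
      classical
      rw [standardMonomial, coeff_monomial, if_neg (fun h : a.1 = b => hb (h ▸ a.2.1))]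
    | zero => simp
    | add y z _ _ hy hz => simp [hy, hz]
    | smul c y _ hy => simp [hy]
  by_contra hne
  have hne' : (x : MvPolynomial (Fin s) K) ≠ 0 := fun h => hne (Subtype.ext h)
  exact m.coeff_degree_ne_zero_iff.2 hne' (hsupp _ fun h => h ⟨_, hxJ, hne', rfl⟩)

theorem finite_footprintDeg (J : Ideal (MvPolynomial (Fin s) K)) (d : ℕ) :
    (footprintDeg m J d).Finite :=
  (linearIndependent_standardMonomial m J d).finite

theorem span_standardMonomial {J : Ideal (MvPolynomial (Fin s) K)} (hJ : IsGraded J) (d : ℕ) :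
    ⊤ ≤ Submodule.span K (Set.range ((gradedPiece J d).mkQ ∘ standardMonomial m J d)) := by
  set W := Submodule.span K (Set.range ((gradedPiece J d).mkQ ∘ standardMonomial m J d)) with hW
  suffices h : ∀ b : m.syn, ∀ x : homogeneousSubmodule (Fin s) K d,
      m.toSyn (m.degree (x : MvPolynomial (Fin s) K)) = b → (gradedPiece J d).mkQ x ∈ W by
    rintro y -
    obtain ⟨x, rfl⟩ := Submodule.mkQ_surjective _ y
    exact h _ x rfl
  intro b
  induction b using WellFoundedLT.induction with
  | ind b ih =>
  rintro x rfl
  by_cases hx0 : x = 0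
  · rw [hx0, map_zero]; exact W.zero_mem
  have hx0' : (x : MvPolynomial (Fin s) K) ≠ 0 := fun h => hx0 (Subtype.ext h)
  have hdeg := degree_degree_eq m x.2 hx0'
  obtain ⟨z, hz0, hzW, hza⟩ : ∃ z : homogeneousSubmodule (Fin s) K d,
      (z : MvPolynomial (Fin s) K) ≠ 0 ∧ (gradedPiece J d).mkQ z ∈ W ∧
        m.degree (x : MvPolynomial (Fin s) K) = m.degree (z : MvPolynomial (Fin s) K) := by
    by_cases hst : m.degree (x : MvPolynomial (Fin s) K) ∈ footprint m J
    · refine ⟨standardMonomial m J d ⟨_, hst, hdeg⟩, ?_, Submodule.subset_span ⟨_, rfl⟩, ?_⟩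
      · simp [standardMonomial]
      · classical
        simp [standardMonomial, m.degree_monomial]
    · obtain ⟨z, hzJ, hz0, hz, hza⟩ := hJ.exists_homogeneous_degree_eq m hst
      rw [hdeg] at hz
      refine ⟨⟨z, hz⟩, hz0, ?_, hza.symm⟩
      have : (gradedPiece J d).mkQ ⟨z, hz⟩ = 0 := by
        rw [Submodule.mkQ_apply, Submodule.Quotient.mk_eq_zero]
        exact hzJ
      rw [this]
      exact W.zero_mem
  obtain ⟨c, hc⟩ := exists_sub_smul_degree_lt m hz0 hza
  have hsum : x = (x - c • z) + c • z := by simp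
  rw [hsum, map_add, map_smul]
  refine W.add_mem ?_ (W.smul_mem c hzW)
  rcases hc with hc | hc
  · have : x - c • z = 0 := Subtype.ext hc
    rw [this, map_zero]
    exact W.zero_mem
  · exact ih _ hc _ rfl

/-- The Hilbert function counts standard monomials. -/
theorem hilbertFn_eq_ncard {J : Ideal (MvPolynomial (Fin s) K)} (hJ : IsGraded J) (d : ℕ) :
    hilbertFn J d = (footprintDeg m J d).ncard :=
  Module.finrank_eq_nat_card_basis
    (Module.Basis.mk (linearIndependent_standardMonomial m J d) (span_standardMonomial m hJ d))

theorem hilbertFn_le_of_footprint_subset {I J : Ideal (MvPolynomial (Fin s) K)} (hI : IsGraded I)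
    (hJ : IsGraded J) (h : footprint m I ⊆ footprint m J) (d : ℕ) :
    hilbertFn I d ≤ hilbertFn J d := by
  rw [hilbertFn_eq_ncard m hI, hilbertFn_eq_ncard m hJ]
  exact Set.ncard_le_ncard (fun a ha => ⟨h ha.1, ha.2⟩) (finite_footprintDeg m J d)

/-- Every leading monomial of a monomial ideal is a multiple of a generator, hence of the leading
monomial of some `g ∈ J`; a monomial multiple of `g` realizes it in `J`. -/
theorem footprint_subset_span_monomial {J : Ideal (MvPolynomial (Fin s) K)}
    {A : Set (Fin s →₀ ℕ)} (hA : ∀ c ∈ A, ∃ g ∈ J, g ≠ 0 ∧ m.degree g = c) :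
    footprint m J ⊆ footprint m (Ideal.span ((fun a => monomial a (1 : K)) '' A)) := by
  rintro b hb ⟨h, hh, h0, rfl⟩
  obtain ⟨c, hc, hcb⟩ := mem_ideal_span_monomial_image.1 hh _ (m.degree_mem_support h0)
  obtain ⟨g, hg, hg0, rfl⟩ := hA c hc
  have hmon : monomial (m.degree h - m.degree g) (1 : K) ≠ 0 := by simp
  refine hb ⟨monomial (m.degree h - m.degree g) 1 * g, J.mul_mem_left _ hg, mul_ne_zero hmon hg0, ?_⟩
  classical
  rw [m.degree_mul hmon hg0, m.degree_monomial, if_neg one_ne_zero, tsub_add_cancel_of_le hcb]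

/-- The exponents of the leading monomials of `I`. -/
def leadingExponents (I : Ideal (MvPolynomial (Fin s) K)) : Set (Fin s →₀ ℕ) :=
  {a | ∃ f ∈ I, f ≠ 0 ∧ m.degree f = a}

theorem initialIdeal_eq (I : Ideal (MvPolynomial (Fin s) K)) :
    initialIdeal m I = Ideal.span ((fun a => monomial a (1 : K)) '' leadingExponents m I) := by
  rw [initialIdeal]
  congr 1
  ext h
  constructor
  · rintro ⟨f, hf, h0, rfl⟩
    exact ⟨_, ⟨f, hf, h0, rfl⟩, rfl⟩
  · rintro ⟨_, ⟨f, hf, h0, rfl⟩, rfl⟩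
    exact ⟨f, hf, h0, rfl⟩

theorem initialIdeal_sup_eq (I : Ideal (MvPolynomial (Fin s) K)) (a : Fin s →₀ ℕ) :
    initialIdeal m I ⊔ Ideal.span {monomial a (1 : K)} =
      Ideal.span ((fun a => monomial a (1 : K)) '' (leadingExponents m I ∪ {a})) := by
  rw [initialIdeal_eq, ← Ideal.span_union, Set.image_union, Set.image_singleton]

theorem isGraded_initialIdeal (I : Ideal (MvPolynomial (Fin s) K)) :
    IsGraded (initialIdeal m I) :=
  isGraded_span fun _ ⟨_, _, _, h⟩ => ⟨_, h ▸ isHomogeneous_monomial 1 rfl⟩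

theorem hilbertFn_initialIdeal {I : Ideal (MvPolynomial (Fin s) K)} (hI : IsGraded I) :
    hilbertFn (initialIdeal m I) = hilbertFn I := by
  funext d
  refine le_antisymm ?_ ?_
  · refine hilbertFn_le_of_footprint_subset m (isGraded_initialIdeal m I) hI ?_ d
    rintro b hb ⟨f, hf, h0, rfl⟩
    refine hb ⟨monomial (m.degree f) 1, Ideal.subset_span ⟨f, hf, h0, rfl⟩, by simp, ?_⟩
    classical
    rw [m.degree_monomial, if_neg one_ne_zero]
  · refine hilbertFn_le_of_footprint_subset m hI (isGraded_initialIdeal m I) ?_ d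
    rw [initialIdeal_eq]
    exact footprint_subset_span_monomial m fun c hc => hc

/-- The monomial ideal on the right lies in the initial ideal of `(I, f)`, possibly strictly, so it
has at least as many standard monomials. -/
theorem hilbertFn_sup_span_le {I : Ideal (MvPolynomial (Fin s) K)} (hI : IsGraded I)
    {f : MvPolynomial (Fin s) K} {e : ℕ} (hf : f.IsHomogeneous e) (h0 : f ≠ 0) (d : ℕ) :
    hilbertFn (I ⊔ Ideal.span {f}) d ≤
      hilbertFn (initialIdeal m I ⊔ Ideal.span {monomial (m.degree f) (1 : K)}) d := by
  refine hilbertFn_le_of_footprint_subset m (hI.sup_span hf)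
    ((isGraded_initialIdeal m I).sup_span (isHomogeneous_monomial 1 rfl)) ?_ d
  rw [initialIdeal_sup_eq]
  refine footprint_subset_span_monomial m ?_
  rintro c (⟨g, hg, hg0, rfl⟩ | rfl)
  · exact ⟨g, Ideal.mem_sup_left hg, hg0, rfl⟩
  · exact ⟨f, Ideal.mem_sup_right (Ideal.mem_span_singleton_self f), h0, rfl⟩

theorem dim_le_dim_of_hilbertFn_le {I J : Ideal (MvPolynomial (Fin s) K)} (hI : IsGraded I)
    (hJ : IsGraded J) (h : ∀ d, hilbertFn I d ≤ hilbertFn J d) : dim I ≤ dim J :=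
  (hasHilbertDim_hilbertFn I hI).mono (hasHilbertDim_hilbertFn J hJ) h

end Footprint

/-! ### Associated primes, unmixedness, and the bounds on the two functions -/

section Unmixed

variable {K : Type u} [Field K] {s : ℕ}

theorem mem_associatedPrimes_iff {I p : Ideal (MvPolynomial (Fin s) K)} :
    p ∈ associatedPrimes (MvPolynomial (Fin s) K) (MvPolynomial (Fin s) K ⧸ I) ↔
      p.IsPrime ∧ ∃ g, p = I.colon {g} := by
  have key : ∀ g : MvPolynomial (Fin s) K,
      (⊥ : Submodule (MvPolynomial (Fin s) K) (MvPolynomial (Fin s) K ⧸ I)).colon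
        {Ideal.Quotient.mk I g} = I.colon {g} := by
    intro g
    ext r
    rw [Submodule.mem_colon_singleton, mem_colon_iff, Submodule.mem_bot]
    exact Ideal.Quotient.eq_zero_iff_mem (a := r * g)
  rw [AssociatedPrimes.mem_iff, isAssociatedPrime_iff]
  refine and_congr_right fun _ => ⟨?_, ?_⟩
  · rintro ⟨x, hx⟩
    obtain ⟨g, rfl⟩ := Ideal.Quotient.mk_surjective x
    exact ⟨g, hx.trans (key g)⟩
  · rintro ⟨g, hg⟩
    exact ⟨_, hg.trans (key g).symm⟩

theorem le_of_mem_associatedPrimes {I p : Ideal (MvPolynomial (Fin s) K)}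
    (hp : p ∈ associatedPrimes (MvPolynomial (Fin s) K) (MvPolynomial (Fin s) K ⧸ I)) : I ≤ p := by
  obtain ⟨-, g, rfl⟩ := mem_associatedPrimes_iff.1 hp
  exact le_colon_singleton I g

theorem mem_associatedPrimes_of_minimalPrimes {I q : Ideal (MvPolynomial (Fin s) K)}
    (hq : q ∈ I.minimalPrimes) :
    q ∈ associatedPrimes (MvPolynomial (Fin s) K) (MvPolynomial (Fin s) K ⧸ I) := by
  refine Module.associatedPrimes.minimalPrimes_annihilator_subset_associatedPrimes _ _ ?_
  rwa [Ideal.annihilator_quotient]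

theorem mem_associatedPrimes_of_colon {I q : Ideal (MvPolynomial (Fin s) K)}
    {f : MvPolynomial (Fin s) K} (hq : q ∈ (I.colon {f}).minimalPrimes) :
    q ∈ associatedPrimes (MvPolynomial (Fin s) K) (MvPolynomial (Fin s) K ⧸ I) := by
  obtain ⟨h1, g, h2⟩ := mem_associatedPrimes_iff.1 (mem_associatedPrimes_of_minimalPrimes hq)
  refine mem_associatedPrimes_iff.2 ⟨h1, g * f, ?_⟩
  rw [h2]
  ext r
  rw [mem_colon_iff, mem_colon_iff, mem_colon_iff, mul_assoc]

theorem exists_associatedPrime_colon_le {I : Ideal (MvPolynomial (Fin s) K)}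
    {g : MvPolynomial (Fin s) K} (hg : g ∉ I) :
    ∃ p ∈ associatedPrimes (MvPolynomial (Fin s) K) (MvPolynomial (Fin s) K ⧸ I),
      I.colon {g} ≤ p := by
  have htop : I.colon {g} ≠ ⊤ := fun h => hg (by
    have : (1 : MvPolynomial (Fin s) K) ∈ I.colon {g} := by rw [h]; trivial
    simpa [mem_colon_iff] using this)
  obtain ⟨q, hq⟩ := Ideal.nonempty_minimalPrimes htop
  exact ⟨q, mem_associatedPrimes_of_colon hq, hq.1.2⟩

/-- Some minimal prime has dimension `dim I`. It is graded, so it satisfies the dimension formula,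
and it is associated, so all associated primes share its height. -/
theorem height_add_dim_of_unmixed {I : Ideal (MvPolynomial (Fin s) K)} (hgr : IsGraded I)
    (hunm : IsUnmixed I) (htop : I ≠ ⊤) {p : Ideal (MvPolynomial (Fin s) K)}
    (hp : p ∈ associatedPrimes (MvPolynomial (Fin s) K) (MvPolynomial (Fin s) K ⧸ I)) :
    p.height + (dim I : ℕ∞) = s := by
  obtain ⟨q, hq, hqd⟩ := exists_minimalPrimes_dim_eq htop
  rw [hunm p hp q (mem_associatedPrimes_of_minimalPrimes hq), ← hqd]
  exact height_add_dim hq.1.1 (hgr.of_minimalPrimes hq)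

-- The dimension formula is available for graded primes, so `p` is replaced by its homogeneous core:
-- a graded prime containing `J`, of height at most that of `p`, hence of dimension at least `dim
-- I`.
attribute [local instance] MvPolynomial.gradedAlgebra in
theorem dim_le_of_le_associatedPrime {I : Ideal (MvPolynomial (Fin s) K)} (hgr : IsGraded I)
    (hunm : IsUnmixed I) (htop : I ≠ ⊤) {p J : Ideal (MvPolynomial (Fin s) K)}
    (hp : p ∈ associatedPrimes (MvPolynomial (Fin s) K) (MvPolynomial (Fin s) K ⧸ I))
    (hJ : IsGraded J) (hJp : J ≤ p) : dim I ≤ dim J := by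
  have hpp : p.IsPrime := (mem_associatedPrimes_iff.1 hp).1
  set q := (p.homogeneousCore (homogeneousSubmodule (Fin s) K)).toIdeal
  have hqp : q ≤ p := Ideal.toIdeal_homogeneousCore_le _ _
  refine le_trans ?_ (dim_anti (hJ.le_homogeneousCore hJp))
  have h1 := height_add_dim_of_unmixed hgr hunm htop hp
  have h2 := height_add_dim hpp.homogeneousCore (IsGraded.homogeneousCore p)
  have h3 : q.height ≤ p.height := Ideal.height_mono hqp
  have hfin : p.height ≠ ⊤ := by
    intro h
    rw [h, top_add] at h1
    exact ENat.natCast_ne_top s h1.symm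
  obtain ⟨a, ha⟩ := ENat.ne_top_iff_exists.1 hfin
  obtain ⟨b, hb⟩ := ENat.ne_top_iff_exists.1 (ne_top_of_le_ne_top hfin h3)
  change q.height + (dim q : ℕ∞) = s at h2
  change dim I ≤ dim q
  rw [← ha] at h1 h3
  rw [← hb] at h2 h3
  norm_cast at h1 h2 h3
  omega

theorem dim_eq_zero_of_X_mem {I : Ideal (MvPolynomial (Fin s) K)} (hgr : IsGraded I)
    (hX : ∀ i, X i ∈ I) : dim I = 0 := by
  by_contra h
  obtain ⟨k, hk⟩ := Nat.exists_eq_succ_of_ne_zero h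
  have h0 : HasHilbertDim (hilbertFn I) 0 := by
    refine Or.inl ⟨rfl, ?_⟩
    filter_upwards [eventually_ge_atTop 1] with d hd
    have := hilbertFn_eq_zero fun f hf => mem_of_X_mem hX hd hf
    simp [this]
  have := (hasHilbertDim_hilbertFn I hgr).mono h0 fun d => le_rfl
  omega

/-- The standing hypotheses: `I` is graded and unmixed with `dim (S/I) ≥ 1`. -/
structure IsUnmixedGraded (I : Ideal (MvPolynomial (Fin s) K)) : Prop where
  graded : IsGraded I
  unmixed : IsUnmixed I
  one_le_dim : 1 ≤ dim I

namespace IsUnmixedGraded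

variable {I : Ideal (MvPolynomial (Fin s) K)}

theorem ne_top (h : IsUnmixedGraded I) : I ≠ ⊤ := by
  rintro rfl
  have := h.one_le_dim
  rw [dim_top] at this
  omega

theorem dim_sup_span (h : IsUnmixedGraded I) {f : MvPolynomial (Fin s) K} {e : ℕ}
    (hf : f.IsHomogeneous e) (hzd : IsZeroDivisorMod I f) :
    dim (I ⊔ Ideal.span {f}) = dim I := by
  obtain ⟨g, hg, hfg⟩ := hzd
  obtain ⟨p, hp, hle⟩ := exists_associatedPrime_colon_le hg
  refine le_antisymm (dim_anti le_sup_left)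
    (dim_le_of_le_associatedPrime h.graded h.unmixed h.ne_top hp (h.graded.sup_span hf)
      (sup_le (le_of_mem_associatedPrimes hp) ?_))
  rw [Ideal.span_singleton_le_iff_mem]
  exact hle (mem_colon_iff.2 hfg)

theorem dim_colon (h : IsUnmixedGraded I) {f : MvPolynomial (Fin s) K} {e : ℕ}
    (hf : f.IsHomogeneous e) (hfI : f ∉ I) : dim (I.colon {f}) = dim I := by
  obtain ⟨p, hp, hle⟩ := exists_associatedPrime_colon_le hfI
  exact le_antisymm (dim_anti (le_colon_singleton I f))
    (dim_le_of_le_associatedPrime h.graded h.unmixed h.ne_top hp (h.graded.colon hf) hle)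

theorem isZeroDivisorMod_of_mem {f : MvPolynomial (Fin s) K} {d : ℕ}
    (hf : f ∈ zeroDivisorForms I d) : IsZeroDivisorMod I f := by
  by_contra hcon
  refine hf.2.2 (le_antisymm (fun g hg => ?_) (le_colon_singleton I f))
  by_contra hgI
  exact hcon ⟨g, hgI, by rw [mul_comm]; exact mem_colon_iff.1 hg⟩

theorem mem_zeroDivisorForms {f : MvPolynomial (Fin s) K} {d : ℕ} (hf : f.IsHomogeneous d)
    (hfI : f ∉ I) (hzd : IsZeroDivisorMod I f) : f ∈ zeroDivisorForms I d := by
  refine ⟨hf, hfI, fun h => ?_⟩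
  obtain ⟨g, hg, hfg⟩ := hzd
  refine hg ?_
  rw [← h, mem_colon_iff, mul_comm]
  exact hfg

theorem _root_.FootprintIdeal.IsZeroDivisorMod.of_dvd {f g : MvPolynomial (Fin s) K}
    (hf : IsZeroDivisorMod I f) (hfg : f ∣ g) : IsZeroDivisorMod I g := by
  obtain ⟨h, hh, hfh⟩ := hf
  obtain ⟨c, rfl⟩ := hfg
  refine ⟨h, hh, ?_⟩
  rw [show f * c * h = c * (f * h) by ring]
  exact I.mul_mem_left _ hfh

theorem degree_sup_span_le (h : IsUnmixedGraded I) {f : MvPolynomial (Fin s) K} {e : ℕ}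
    (hf : f.IsHomogeneous e) (hzd : IsZeroDivisorMod I f) :
    degree (I ⊔ Ideal.span {f}) ≤ degree I :=
  degree_le_degree (h.graded.sup_span hf) h.graded (h.dim_sup_span hf hzd) h.one_le_dim
    (hilbertFn_anti le_sup_left)

/-- Comparison of `(I, f)` with the initial ideal. -/
theorem degree_initialIdeal_sup (h : IsUnmixedGraded I) (m : MonomialOrder.{0, v} (Fin s))
    {f : MvPolynomial (Fin s) K} {e : ℕ} (hf : f.IsHomogeneous e) (h0 : f ≠ 0)
    (hzd : IsZeroDivisorMod I f) :
    degree (I ⊔ Ideal.span {f}) ≤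
        degree (initialIdeal m I ⊔ Ideal.span {monomial (m.degree f) (1 : K)}) ∧
      degree (initialIdeal m I ⊔ Ideal.span {monomial (m.degree f) (1 : K)}) ≤ degree I := by
  have hg1 := h.graded.sup_span hf
  have hg2 : IsGraded (initialIdeal m I ⊔ Ideal.span {monomial (m.degree f) (1 : K)}) :=
    (isGraded_initialIdeal m I).sup_span (isHomogeneous_monomial 1 rfl)
  have hle1 := hilbertFn_sup_span_le m h.graded hf h0
  have hle2 : ∀ d, hilbertFn (initialIdeal m I ⊔ Ideal.span {monomial (m.degree f) (1 : K)}) d ≤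
      hilbertFn I d := fun d => by
    rw [← hilbertFn_initialIdeal m h.graded]
    exact hilbertFn_anti le_sup_left d
  -- All three dimensions agree, since the outer two do; only then do the Hilbert function
  -- inequalities pass to degrees.
  have hd := h.dim_sup_span hf hzd
  have hd1 := dim_le_dim_of_hilbertFn_le hg1 hg2 hle1
  have hd2 := dim_le_dim_of_hilbertFn_le hg2 h.graded hle2
  have hpos := h.one_le_dim
  exact ⟨degree_le_degree hg1 hg2 (by omega) (by omega) hle1,
    degree_le_degree hg2 h.graded (by omega) (by omega) hle2⟩

/-- A minimal prime of positive dimension misses some variable, and no power of that variable lies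
in `I`. -/
theorem zeroDivisorForms_nonempty (h : IsUnmixedGraded I)
    (hzd : ∀ i : Fin s, IsZeroDivisorMod I (X i)) {d : ℕ} (hd : 1 ≤ d) :
    (zeroDivisorForms I d).Nonempty := by
  obtain ⟨q, hq, hqd⟩ := exists_minimalPrimes_dim_eq h.ne_top
  have hX : ∃ i, X i ∉ q := by
    by_contra! hX
    have := dim_eq_zero_of_X_mem (h.graded.of_minimalPrimes hq) hX
    have := h.one_le_dim
    omega
  obtain ⟨i, hi⟩ := hX
  refine ⟨X i ^ d, mem_zeroDivisorForms (by simpa using (isHomogeneous_X K i).pow d)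
    (fun hmem => hi (hq.1.1.mem_of_pow_mem d (hq.1.2 hmem)))
    ((hzd i).of_dvd (dvd_pow_self _ (by omega)))⟩

theorem bddAbove_degree (h : IsUnmixedGraded I) (d : ℕ) :
    BddAbove ((fun f => degree (I ⊔ Ideal.span {f})) '' zeroDivisorForms I d) := by
  refine ⟨degree I, ?_⟩
  rintro _ ⟨f, hf, rfl⟩
  exact h.degree_sup_span_le hf.1 (isZeroDivisorMod_of_mem hf)

/-- The minimum distance is attained. -/
theorem exists_minDist_eq (h : IsUnmixedGraded I) {d : ℕ}
    (hne : (zeroDivisorForms I d).Nonempty) :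
    ∃ f ∈ zeroDivisorForms I d,
      minDist I d = (degree I : ℤ) - (degree (I ⊔ Ideal.span {f}) : ℤ) ∧
      ∀ g ∈ zeroDivisorForms I d, degree (I ⊔ Ideal.span {g}) ≤ degree (I ⊔ Ideal.span {f}) := by
  obtain ⟨f, hf, hfe⟩ := Nat.sSup_mem (hne.image _) (h.bddAbove_degree d)
  refine ⟨f, hf, ?_, fun g hg => ?_⟩
  · rw [minDist, if_pos hne, ← hfe]
  · have hfe' : degree (I ⊔ Ideal.span {f}) = _ := hfe
    rw [hfe']
    exact le_csSup (h.bddAbove_degree d) ⟨g, hg, rfl⟩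

theorem minDist_le (h : IsUnmixedGraded I) {d : ℕ} {f : MvPolynomial (Fin s) K}
    (hf : f ∈ zeroDivisorForms I d) :
    minDist I d ≤ (degree I : ℤ) - (degree (I ⊔ Ideal.span {f}) : ℤ) := by
  obtain ⟨g, -, hg, hmax⟩ := h.exists_minDist_eq ⟨f, hf⟩
  have := hmax f hf
  omega

theorem minDist_nonneg (h : IsUnmixedGraded I) (d : ℕ) : 0 ≤ minDist I d := by
  by_cases hne : (zeroDivisorForms I d).Nonempty
  · obtain ⟨f, hf, hfe, -⟩ := h.exists_minDist_eq hne
    have := h.degree_sup_span_le hf.1 (isZeroDivisorMod_of_mem hf)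
    omega
  · rw [minDist, if_neg hne]
    omega

/-- A nonzero class is not killed by all the variables. -/
theorem exists_X_mul_notMem (h : IsUnmixedGraded I) {f : MvPolynomial (Fin s) K} {e : ℕ}
    (hf : f.IsHomogeneous e) (hfI : f ∉ I) : ∃ i, X i * f ∉ I := by
  by_contra! hX
  have h1 := dim_eq_zero_of_X_mem (h.graded.colon hf) fun i => mem_colon_iff.2 (hX i)
  have h2 := h.dim_colon hf hfI
  have := h.one_le_dim
  omega

/-- An optimal `f` times a variable keeping it outside `I` is still a zero-divisor, and `(I, X i *
f)` is contained in `(I, f)`. -/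
theorem minDist_succ_le (h : IsUnmixedGraded I) {d : ℕ}
    (hne : (zeroDivisorForms I d).Nonempty) : minDist I (d + 1) ≤ minDist I d := by
  obtain ⟨f, hf, hfe, -⟩ := h.exists_minDist_eq hne
  obtain ⟨i, hi⟩ := h.exists_X_mul_notMem hf.1 hf.2.1
  have hhom : (X i * f).IsHomogeneous (d + 1) := by
    rw [add_comm]
    exact (isHomogeneous_X K i).mul hf.1
  have hzd := (isZeroDivisorMod_of_mem hf).of_dvd (dvd_mul_left f (X i))
  have hmem := mem_zeroDivisorForms hhom hi hzd
  have h1 := h.minDist_le hmem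
  have hle : I ⊔ Ideal.span {X i * f} ≤ I ⊔ Ideal.span {f} :=
    sup_le_sup_left (Ideal.span_singleton_le_span_singleton.2 (dvd_mul_left f (X i))) I
  have hd1 := h.dim_sup_span hf.1 (isZeroDivisorMod_of_mem hf)
  have hd2 := h.dim_sup_span hhom hzd
  have h2 := degree_le_degree (h.graded.sup_span hf.1) (h.graded.sup_span hhom)
    (hd1.trans hd2.symm) (hd2 ▸ h.one_le_dim) (hilbertFn_anti hle)
  omega

theorem degree_monomial_bounds (h : IsUnmixedGraded I) (m : MonomialOrder.{0, v} (Fin s))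
    (hzd : ∀ i : Fin s, IsZeroDivisorMod I (X i)) (a : Fin s →₀ ℕ) :
    degree (I ⊔ Ideal.span {monomial a (1 : K)}) ≤
        degree (initialIdeal m I ⊔ Ideal.span {monomial a (1 : K)}) ∧
      degree (initialIdeal m I ⊔ Ideal.span {monomial a (1 : K)}) ≤ degree I := by
  -- The monomial 1 need not be a zero-divisor, but it makes both ideals the whole ring, of degree
  -- 0.
  by_cases ha : a = 0
  · have h1 : Ideal.span {monomial a (1 : K)} = (⊤ : Ideal (MvPolynomial (Fin s) K)) := by
      rw [ha]
      exact Ideal.span_singleton_one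
    rw [h1, sup_top_eq, sup_top_eq, degree_top]
    exact ⟨le_rfl, Nat.zero_le _⟩
  · obtain ⟨i, hi⟩ := Finsupp.ne_iff.1 ha
    have h1 : IsZeroDivisorMod I (monomial a (1 : K)) :=
      (hzd i).of_dvd (X_dvd_monomial.2 (Or.inr hi))
    classical
    have h2 := h.degree_initialIdeal_sup m (isHomogeneous_monomial (1 : K) rfl)
      (by simp : monomial a (1 : K) ≠ 0) h1
    rwa [m.degree_monomial, if_neg one_ne_zero] at h2

theorem bddAbove_degree_footprint (h : IsUnmixedGraded I) (m : MonomialOrder.{0, v} (Fin s))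
    (hzd : ∀ i : Fin s, IsZeroDivisorMod I (X i)) (d : ℕ) :
    degree I ∈ upperBounds ((fun a => degree (initialIdeal m I ⊔ Ideal.span {monomial a (1 : K)})) ''
      footprintDeg m I d) := by
  rintro _ ⟨a, -, rfl⟩
  exact (h.degree_monomial_bounds m hzd a).2

theorem footprintFn_nonneg (h : IsUnmixedGraded I) (m : MonomialOrder.{0, v} (Fin s))
    (hzd : ∀ i : Fin s, IsZeroDivisorMod I (X i)) (d : ℕ) : 0 ≤ footprintFn m I d := by
  rw [footprintFn]
  split_ifs with hne
  · have := csSup_le (hne.image _) (h.bddAbove_degree_footprint m hzd d)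
    omega
  · omega

/-- An optimal `f` is replaced by a form congruent to it modulo `I` with standard leading monomial;
this changes neither `(I, f)` nor the zero-divisor property. -/
theorem footprintFn_le_minDist (h : IsUnmixedGraded I) (m : MonomialOrder.{0, v} (Fin s))
    (hzd : ∀ i : Fin s, IsZeroDivisorMod I (X i)) {d : ℕ} (hd : 1 ≤ d) :
    footprintFn m I d ≤ minDist I d := by
  obtain ⟨f, hf, hfe, -⟩ := h.exists_minDist_eq (h.zeroDivisorForms_nonempty hzd hd)
  obtain ⟨g, hg, hg0, hfg, hgd⟩ := h.graded.exists_standard_form m hf.1 hf.2.1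
  have hsup : I ⊔ Ideal.span {f} = I ⊔ Ideal.span {g} := by
    have h1 : f = (f - g) + g := by ring
    have h2 : g = -(f - g) + f := by ring
    apply le_antisymm <;> refine sup_le le_sup_left ?_ <;> rw [Ideal.span_singleton_le_iff_mem]
    · rw [h1]
      exact Ideal.add_mem _ (Ideal.mem_sup_left hfg)
        (Ideal.mem_sup_right (Ideal.mem_span_singleton_self g))
    · rw [h2]
      exact Ideal.add_mem _ (Ideal.mem_sup_left (I.neg_mem hfg))
        (Ideal.mem_sup_right (Ideal.mem_span_singleton_self f))
  have hgz : IsZeroDivisorMod I g := by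
    obtain ⟨r, hr, hfr⟩ := isZeroDivisorMod_of_mem hf
    refine ⟨r, hr, ?_⟩
    have := I.sub_mem hfr (I.mul_mem_right r hfg)
    rwa [show f * r - (f - g) * r = g * r by ring] at this
  have h3 := (h.degree_initialIdeal_sup m hg hg0 hgz).1
  rw [← hsup] at h3
  have h4 := le_csSup ⟨_, h.bddAbove_degree_footprint m hzd d⟩ ⟨m.degree g, hgd, rfl⟩
  rw [footprintFn, if_pos ⟨_, hgd⟩, hfe]
  simp only at h4
  omega

end IsUnmixedGraded

end Unmixed

/-! ### Linear primes and strict decrease of the minimum distance -/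

section Linear

variable {K : Type u} [Field K] {s : ℕ}

theorem hilbertFn_zero_le_one (I : Ideal (MvPolynomial (Fin s) K)) : hilbertFn I 0 ≤ 1 := by
  refine finrank_le_one ((gradedPiece I 0).mkQ ⟨1, isHomogeneous_one _ _⟩) fun w => ?_
  obtain ⟨x, rfl⟩ := Submodule.mkQ_surjective _ w
  refine ⟨coeff 0 (x : MvPolynomial (Fin s) K), ?_⟩
  rw [← map_smul]
  congr 1
  refine Subtype.ext ?_
  have h1 : homogeneousComponent 0 (x : MvPolynomial (Fin s) K) = x :=
    homogeneousComponent_eq_self x.2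
  rw [homogeneousComponent_zero] at h1
  rw [← h1]
  simp [smul_eq_C_mul]

/-- If `S/Q` is generated in degree one by `c` variables, its Hilbert function is at most that of a
polynomial ring in `c` variables. -/
theorem hilbertFn_le_multichoose (L : List (Fin s)) :
    ∀ Q : Ideal (MvPolynomial (Fin s) K), IsGraded Q →
      (∀ j, X j ∈ Q ⊔ Ideal.span {f | ∃ i ∈ L, f = X i}) →
      ∀ d, hilbertFn Q d ≤ Nat.multichoose L.length d := by
  induction L with
  | nil =>
    intro Q hQ hX d
    rcases d with _ | d
    · simpa using hilbertFn_zero_le_one Q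
    · have hX' : ∀ j, X j ∈ Q := by simpa using hX
      rw [hilbertFn_eq_zero fun f hf => mem_of_X_mem hX' (Nat.succ_pos d) hf]
      exact Nat.zero_le _
  | cons i L ih =>
    intro Q hQ hX d
    have hXi : (X i : MvPolynomial (Fin s) K).IsHomogeneous 1 := isHomogeneous_X _ _
    have hQ' := hQ.sup_span hXi
    have hset : {f : MvPolynomial (Fin s) K | ∃ j ∈ i :: L, f = X j} =
        {X i} ∪ {f | ∃ j ∈ L, f = X j} := by
      ext f
      simp
    have hih := ih _ hQ' fun j => by
      have := hX j
      rwa [hset, Ideal.span_union, ← sup_assoc] at this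
    induction d with
    | zero => simpa using hilbertFn_zero_le_one Q
    | succ d ihd =>
      -- The Hilbert function obeys Pascal's recurrence up to an inequality, because `(Q : X i)`
      -- contains `Q`.
      rw [hilbertFn_add hQ hXi, List.length_cons, Nat.multichoose_succ_succ, add_comm]
      exact add_le_add (hih _) ((hilbertFn_anti (le_colon_singleton Q _) d).trans ihd)

/-- A prime generated by linear forms is generated by a set of them which, together with at most
`dim (S/Q)` variables, generates all linear forms. -/
theorem exists_list_of_isLinearlyGenerated {Q : Ideal (MvPolynomial (Fin s) K)} (hQ : Q.IsPrime)
    (hgr : IsGraded Q) (hlin : IsLinearlyGenerated Q) :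
    ∃ L : List (Fin s), L.length ≤ dim Q ∧
      ∀ j, X j ∈ Q ⊔ Ideal.span {f | ∃ i ∈ L, f = X i} := by
  classical
  obtain ⟨A, hA, rfl⟩ := hlin
  obtain ⟨B, hBA, hspan, hBli⟩ := exists_linearIndependent K A
  have hBQ : Ideal.span A = Ideal.span B := by
    refine le_antisymm (Ideal.span_le.2 fun a ha => ?_) (Ideal.span_mono hBA)
    have h1 : a ∈ Submodule.span K B := by rw [hspan]; exact Submodule.subset_span ha
    exact Submodule.span_le_restrictScalars K (MvPolynomial (Fin s) K) B h1
  have hBli' : LinearIndepOn K id B := hBli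
  -- The independent linear generators `B` are completed by variables to a basis of the linear
  -- forms; the variables added form the list.
  obtain ⟨b, hb, hBb, hXb, hbli⟩ := exists_linearIndepOn_id_extension hBli'
    (Set.subset_union_left (s := B) (t := Set.range (X : Fin s → MvPolynomial (Fin s) K)))
  have hb1 : ∀ f ∈ b, f.IsHomogeneous 1 := by
    intro f hf
    rcases hb hf with h | ⟨i, rfl⟩
    · exact hA f (hBA h)
    · exact isHomogeneous_X _ _
  let w : b → homogeneousSubmodule (Fin s) K 1 := fun f => ⟨f.1, hb1 f.1 f.2⟩
  have hw : LinearIndependent K w :=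
    LinearIndependent.of_comp (homogeneousSubmodule (Fin s) K 1).subtype hbli
  have hfin : Finite b := hw.finite
  have := Fintype.ofFinite b
  have hcard := hw.fintype_card_le_finrank
  have hfr : Module.finrank K (homogeneousSubmodule (Fin s) K 1) ≤ s := by
    rw [homogeneousSubmodule_one_eq_span_X]
    exact (finrank_range_le_card (R := K) (X : Fin s → MvPolynomial (Fin s) K)).trans_eq
      (Fintype.card_fin s)
  have hbs : b.ncard ≤ s := by
    rw [← Nat.card_coe_set_eq, Nat.card_eq_fintype_card]
    exact hcard.trans hfr
  have hbfin : b.Finite := Set.toFinite b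
  have hBfin : B.Finite := hbfin.subset hBb
  have hsub : b \ B ⊆ Set.range X := fun f hf => (hb hf.1).resolve_left hf.2
  -- By Krull's height theorem, so at most `s - B.ncard ≤ s - height = dim` variables are added.
  have hht : (Ideal.span A).height ≤ B.ncard := by
    rw [hBQ] at hQ ⊢
    refine Ideal.height_le_card_of_mem_minimalPrimes_span hBfin ?_
    rw [Ideal.minimalPrimes_eq_subsingleton_self]
    rfl
  have hdim := height_add_dim hQ hgr
  have hcount : (b \ B).ncard + B.ncard = b.ncard := Set.ncard_sdiff_add_ncard_of_subset hBb hbfin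
  have hle : (b \ B).ncard ≤ dim (Ideal.span A) := by
    obtain ⟨t, ht⟩ := ENat.ne_top_iff_exists.1 (ne_top_of_le_ne_top (ENat.natCast_ne_top _) hht)
    rw [← ht] at hht hdim
    norm_cast at hht hdim
    omega
  set J : Finset (Fin s) := Finset.univ.filter fun i => (X i : MvPolynomial (Fin s) K) ∈ b \ B
  refine ⟨J.toList, ?_, fun j => ?_⟩
  · rw [Finset.length_toList]
    have h1 : (J.image (X : Fin s → MvPolynomial (Fin s) K)).card = J.card :=
      Finset.card_image_of_injective _ (X_injective)
    have h2 : ((J.image (X : Fin s → MvPolynomial (Fin s) K) : Finset _) : Set _) ⊆ b \ B := by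
      intro f hf
      obtain ⟨i, hi, rfl⟩ := Finset.mem_image.1 (Finset.mem_coe.1 hf)
      exact (Finset.mem_filter.1 hi).2
    have h3 := Set.ncard_le_ncard h2 hbfin.sdiff
    rw [Set.ncard_coe_finset, h1] at h3
    exact h3.trans hle
  · have h1 : (X j : MvPolynomial (Fin s) K) ∈ Submodule.span K b := hXb (Or.inr ⟨j, rfl⟩)
    have h2 := Submodule.span_le_restrictScalars K (MvPolynomial (Fin s) K) b h1
    refine (Ideal.span_le.2 fun f hf => ?_ : Ideal.span b ≤ _) h2
    by_cases hfB : f ∈ B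
    · exact Ideal.mem_sup_left (Ideal.subset_span (hBA hfB))
    · obtain ⟨i, rfl⟩ := hsub ⟨hf, hfB⟩
      refine Ideal.mem_sup_right (Ideal.subset_span ⟨i, ?_, rfl⟩)
      rw [Finset.mem_toList, Finset.mem_filter]
      exact ⟨Finset.mem_univ _, hf, hfB⟩

theorem degree_le_one_of_isLinearlyGenerated {Q : Ideal (MvPolynomial (Fin s) K)} (hQ : Q.IsPrime)
    (hgr : IsGraded Q) (hlin : IsLinearlyGenerated Q) (hpos : 1 ≤ dim Q) : degree Q ≤ 1 := by
  obtain ⟨L, hL, hX⟩ := exists_list_of_isLinearlyGenerated hQ hgr hlin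
  have hle := hilbertFn_le_multichoose L Q hgr hX
  obtain ⟨k, hk⟩ : ∃ k, dim Q = k + 1 := ⟨dim Q - 1, by omega⟩
  have hd := (hasDiff_degree hgr hk).1
  rcases (hL.trans hk.le).eq_or_lt with hc | hc
  · rw [hc] at hle
    have := hd.mono (hasDiff_multichoose k) hle
    omega
  · have := hd.mono ((hasHilbertDim_multichoose L.length).hasDiff_zero (Nat.lt_succ_iff.1 hc)) hle
    omega

namespace IsUnmixedGraded

variable {I : Ideal (MvPolynomial (Fin s) K)}

theorem degree_eq_add (h : IsUnmixedGraded I) {f : MvPolynomial (Fin s) K} {d : ℕ}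
    (hf : f ∈ zeroDivisorForms I d) :
    degree I = degree (I.colon {f}) + degree (I ⊔ Ideal.span {f}) :=
  FootprintIdeal.degree_eq_add h.graded hf.1 h.one_le_dim (h.dim_colon hf.1 hf.2.1)
    (h.dim_sup_span hf.1 (isZeroDivisorMod_of_mem hf))

theorem degree_colon_pos (h : IsUnmixedGraded I) {f : MvPolynomial (Fin s) K} {d : ℕ}
    (hf : f ∈ zeroDivisorForms I d) : 1 ≤ degree (I.colon {f}) := by
  obtain ⟨k, hk⟩ : ∃ k, dim I = k + 1 := ⟨dim I - 1, by have := h.one_le_dim; omega⟩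
  exact (hasDiff_degree (h.graded.colon hf.1) ((h.dim_colon hf.1 hf.2.1).trans hk)).2

/-- By additivity the minimum distance is the degree of a colon ideal of the same positive dimension
as `I`. -/
theorem one_le_minDist (h : IsUnmixedGraded I) {d : ℕ} (hne : (zeroDivisorForms I d).Nonempty) :
    1 ≤ minDist I d := by
  obtain ⟨f, hf, hfe, -⟩ := h.exists_minDist_eq hne
  have := h.degree_eq_add hf
  have := h.degree_colon_pos hf
  omega

/-- For a radical ideal whose associated primes are generated by linear forms, a form whose
colon ideal has degree at least two can be multiplied by a linear form so as to lower it. -/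
theorem exists_linear_mul (h : IsUnmixedGraded I) (hrad : I.IsRadical)
    (hlin : ∀ p ∈ associatedPrimes (MvPolynomial (Fin s) K) (MvPolynomial (Fin s) K ⧸ I),
      IsLinearlyGenerated p)
    {f : MvPolynomial (Fin s) K} {d : ℕ} (hf : f ∈ zeroDivisorForms I d)
    (h2 : 2 ≤ degree (I.colon {f})) :
    ∃ g ∈ zeroDivisorForms I (d + 1), degree (I.colon {g}) < degree (I.colon {f}) := by
  have hJgr := h.graded.colon hf.1
  have hJdim := h.dim_colon hf.1 hf.2.1
  have hpos := h.one_le_dim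
  have hJtop : I.colon {f} ≠ ⊤ := fun ht => by
    rw [ht, dim_top] at hJdim
    omega
  obtain ⟨q, hq, hqd⟩ := exists_minimalPrimes_dim_eq hJtop
  have hqgr := hJgr.of_minimalPrimes hq
  have hqlin := hlin q (mem_associatedPrimes_of_colon hq)
  have hqdeg := degree_le_one_of_isLinearlyGenerated hq.1.1 hqgr hqlin (by omega)
  have hJrad : (I.colon {f}).IsRadical := by
    rintro r ⟨n, hn⟩
    rw [mem_colon_iff] at hn ⊢
    refine hrad ⟨n + 1, ?_⟩
    rw [show (r * f) ^ (n + 1) = r * f ^ n * (r ^ n * f) by ring]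
    exact I.mul_mem_left _ hn
  -- With a single minimal prime, the radical ideal `(I : f)` would equal `q`, whose degree is at
  -- most 1.
  obtain ⟨q', hq', hne⟩ : ∃ q' ∈ (I.colon {f}).minimalPrimes, q' ≠ q := by
    by_contra! hall
    have h3 : (I.colon {f}).minimalPrimes = {q} :=
      Set.eq_singleton_iff_unique_mem.2 ⟨hq, hall⟩
    have h4 : I.colon {f} = q := by
      rw [← hJrad.radical, ← Ideal.sInf_minimalPrimes, h3, sInf_singleton]
    rw [h4] at h2
    omega
  have hnle : ¬ q ≤ q' := fun hle => hne (le_antisymm (hq'.2 hq.1 hle) hle)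
  obtain ⟨A, hA, hqA⟩ := hqlin
  obtain ⟨l, hlA, hlq'⟩ : ∃ l ∈ A, l ∉ q' := by
    by_contra! hall
    exact hnle (hqA ▸ Ideal.span_le.2 hall)
  have hlq : l ∈ q := hqA ▸ Ideal.subset_span hlA
  have hl1 := hA l hlA
  have hlf : l * f ∉ I := fun hmem => hlq' (hq'.1.2 (mem_colon_iff.2 hmem))
  have hhom : (l * f).IsHomogeneous (d + 1) := by
    rw [add_comm]
    exact hl1.mul hf.1
  have hmem := mem_zeroDivisorForms hhom hlf
    ((isZeroDivisorMod_of_mem hf).of_dvd (dvd_mul_left f l))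
  refine ⟨l * f, hmem, ?_⟩
  have hcolon : (I.colon {f}).colon {l} = I.colon {l * f} := by
    ext r
    rw [mem_colon_iff, mem_colon_iff, mem_colon_iff, mul_assoc]
  have hsupdim : dim (I.colon {f} ⊔ Ideal.span {l}) = dim (I.colon {f}) := by
    refine le_antisymm (dim_anti le_sup_left) ?_
    rw [← hqd]
    refine dim_anti (sup_le hq.1.2 ?_)
    rwa [Ideal.span_singleton_le_iff_mem]
  -- As `l ∉ q'`, the product `l * f` stays outside `I`; as `l ∈ q`, adding `l` keeps the dimension.
  -- So `(I:f) + (l)` has positive degree, which is exactly the drop.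
  have hadd := FootprintIdeal.degree_eq_add hJgr hl1 (by omega)
    (by rw [hcolon, h.dim_colon hhom hlf, hJdim]) hsupdim
  rw [hcolon] at hadd
  obtain ⟨k, hk⟩ : ∃ k, dim I = k + 1 := ⟨dim I - 1, by omega⟩
  have := (hasDiff_degree (hJgr.sup_span hl1) (hsupdim.trans (hJdim.trans hk))).2
  omega

theorem minDist_succ_lt (h : IsUnmixedGraded I) (hrad : I.IsRadical)
    (hlin : ∀ p ∈ associatedPrimes (MvPolynomial (Fin s) K) (MvPolynomial (Fin s) K ⧸ I),
      IsLinearlyGenerated p)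
    {d : ℕ} (hne : (zeroDivisorForms I d).Nonempty) (h2 : 2 ≤ minDist I d) :
    minDist I (d + 1) < minDist I d := by
  obtain ⟨f, hf, hfe, -⟩ := h.exists_minDist_eq hne
  have hadd := h.degree_eq_add hf
  obtain ⟨g, hg, hlt⟩ := h.exists_linear_mul hrad hlin hf (by omega)
  have hle := h.minDist_le hg
  have hadd' := h.degree_eq_add hg
  omega

end IsUnmixedGraded

end Linear

end FootprintIdeal

end

theorem theorem4p3 {K : Type u} [Field K] {s : ℕ} (m : MonomialOrder.{0, v} (Fin s))
    (I : Ideal (MvPolynomial (Fin s) K))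
    (hgr : FootprintIdeal.IsGraded I)
    (hunm : FootprintIdeal.IsUnmixed I)
    (hdim : 1 ≤ ringKrullDim (MvPolynomial (Fin s) K ⧸ I))
    (hzd : ∀ i : Fin s, FootprintIdeal.IsZeroDivisorMod I (MvPolynomial.X i)) :
    -- (i), with the existence of the maximum that defines the minimum distance function
    (∀ d : ℕ, 1 ≤ d → (FootprintIdeal.zeroDivisorForms I d).Nonempty ∧
      ∃ f ∈ FootprintIdeal.zeroDivisorForms I d, ∀ g ∈ FootprintIdeal.zeroDivisorForms I d,
        FootprintIdeal.degree (I ⊔ Ideal.span {g}) ≤ FootprintIdeal.degree (I ⊔ Ideal.span {f})) ∧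
    -- (ii)
    (∀ d : ℕ, 1 ≤ d → FootprintIdeal.footprintFn m I d ≤ FootprintIdeal.minDist I d) ∧
    -- (iii)
    (∀ a ∈ FootprintIdeal.footprint m I,
      FootprintIdeal.degree (I ⊔ Ideal.span {MvPolynomial.monomial a (1 : K)}) ≤
        FootprintIdeal.degree
          (FootprintIdeal.initialIdeal m I ⊔ Ideal.span {MvPolynomial.monomial a (1 : K)}) ∧
      FootprintIdeal.degree
          (FootprintIdeal.initialIdeal m I ⊔ Ideal.span {MvPolynomial.monomial a (1 : K)}) ≤
        FootprintIdeal.degree I) ∧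
    -- (iv)
    (∀ d : ℕ, 0 ≤ FootprintIdeal.footprintFn m I d) ∧
    -- (v)
    (∀ d : ℕ, 1 ≤ d → FootprintIdeal.minDist I (d + 1) ≤ FootprintIdeal.minDist I d ∧
      0 ≤ FootprintIdeal.minDist I (d + 1)) ∧
    -- (vi)
    (I.IsRadical →
      (∀ p ∈ associatedPrimes (MvPolynomial (Fin s) K) (MvPolynomial (Fin s) K ⧸ I),
        FootprintIdeal.IsLinearlyGenerated p) →
      ∃ r : ℕ, 1 ≤ r ∧
        (∀ d : ℕ, 1 ≤ d → d < r → FootprintIdeal.minDist I (d + 1) < FootprintIdeal.minDist I d) ∧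
        (∀ d : ℕ, r ≤ d → FootprintIdeal.minDist I d = 1)) := by
  have htop : I ≠ ⊤ := by
    rintro rfl
    have : Subsingleton (MvPolynomial (Fin s) K ⧸ (⊤ : Ideal (MvPolynomial (Fin s) K))) :=
      Ideal.Quotient.subsingleton_iff.2 rfl
    rw [ringKrullDim_eq_bot_of_subsingleton] at hdim
    simp at hdim
  have h : FootprintIdeal.IsUnmixedGraded I := by
    refine ⟨hgr, hunm, ?_⟩
    rw [← FootprintIdeal.coe_dim htop] at hdim
    exact_mod_cast hdim
  have hne : ∀ d, 1 ≤ d → (FootprintIdeal.zeroDivisorForms I d).Nonempty :=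
    fun d hd => h.zeroDivisorForms_nonempty hzd hd
  refine ⟨fun d hd => ⟨hne d hd, ?_⟩, fun d hd => h.footprintFn_le_minDist m hzd hd,
    fun a _ => h.degree_monomial_bounds m hzd a, h.footprintFn_nonneg m hzd,
    fun d hd => ⟨h.minDist_succ_le (hne d hd), h.minDist_nonneg _⟩, fun hrad hlin => ?_⟩
  · obtain ⟨f, hf, -, hmax⟩ := h.exists_minDist_eq (hne d hd)
    exact ⟨f, hf, hmax⟩
  · have hone : ∀ d, 1 ≤ d → 1 ≤ FootprintIdeal.minDist I d :=
      fun d hd => h.one_le_minDist (hne d hd)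
    have hlt : ∀ d, 1 ≤ d → FootprintIdeal.minDist I d ≠ 1 →
        FootprintIdeal.minDist I (d + 1) < FootprintIdeal.minDist I d := fun d hd h1 =>
      h.minDist_succ_lt hrad hlin (hne d hd) (by have := hone d hd; omega)
    have hex : ∃ r, 1 ≤ r ∧ FootprintIdeal.minDist I r = 1 := by
      by_contra! hall
      have hdec : ∀ n : ℕ, FootprintIdeal.minDist I (n + 1) + n ≤ FootprintIdeal.minDist I 1 := by
        intro n
        induction n with
        | zero => simp
        | succ n ih =>
          have := hlt (n + 1) (by omega) (hall _ (by omega))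
          push_cast
          omega
      -- After as many strict drops as the initial value, the function would be at most 0,
      -- contradicting `hone`.
      have h1 := hdec (FootprintIdeal.minDist I 1).toNat
      have h2 := hone ((FootprintIdeal.minDist I 1).toNat + 1) (by omega)
      have h3 := hone 1 le_rfl
      omega
    classical
    refine ⟨Nat.find hex, (Nat.find_spec hex).1, fun d hd hdr => hlt d hd fun h1 =>
      Nat.find_min hex hdr ⟨hd, h1⟩, fun d hd => ?_⟩
    induction d, hd using Nat.le_induction with
    | base => exact (Nat.find_spec hex).2
    | succ d hd ih =>
      have hd1 : 1 ≤ d := (Nat.find_spec hex).1.trans hd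
      have h1 := h.minDist_succ_le (hne d hd1)
      have h2 := hone (d + 1) (by omega)
      omega
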